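/- **Theorem (Discrete Coleman–Mandula theorem).** Let $d\ge 1$, and consider a quantum field theory on Minkowski space $\mathbb{R}^d$ with metric of signature $(d-1,1)$: a Hilbert space $\mathcal{H}$, a von Neumann algebra $\mathcal{A}[R]$ on $\mathcal H$ for every (relatively open) region $R$ of a Cauchy slice, with $\mathcal{A}[R]\subset\mathcal{A}[R']$ whenever $R$ lies in the domain of dependence $D[R']$, such that bosonic/fermionic operators in spacelike separated regions commute/anticommute, and a set of local operators (operator-valued distributions) whose smearings with test functions supported in $D[R]$ are affiliated with $\mathcal{A}[R]$. Let this theory have a global symmetry with symmetry group $G$, where $G$ is a finite-dimensional Lie group. This means the following. * There is a homomorphism $U$ from $G$ to the unitary and antiunitary operators on $\mathcal H$. * There is a smooth homomorphism $g\mapsto f_g$ from $G$ to the group of conformal transformations of $\mathbb{R}^d$ (or of its conformal compactification, the projective null cone of $\mathbb{R}^{d,2}$, on which special conformal transformations are defined everywhere). It satisfies $U(g)^\dagger\mathcal{A}[R]U(g)=\mathcal{A}[f_{g^{-1}}(R)]$ whenever $f_{g^{-1}}$ keeps $D[R]$ within $\mathbb{R}^d$ and $f_{g^{-1}}(R)$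 is again a region of a Cauchy slice. * For bounded $R$, the map $(g,\mathcal O)\mapsto U(g)^\dagger\mathcal O\,U(g)$ is jointly continuous in the strong operator topology on uniformly bounded subsets of $\mathcal{A}[R]$. * For every $g\ne e$ there is a local operator $\mathcal O$ with $U(g)^\dagger\mathcal O\,U(g)\neq\mathcal O$. No condition is imposed on the transformation of the stress tensor. Let $G_I=\{g\in G: f_g=\mathrm{id}\}$ be the internal subgroup, and suppose: 1. $G$ contains, as a Lie subgroup $\hat G_0$ whose elements act on spacetime in the standard way, either (with $d\geq 3$) the identity component $\mathbb{R}^d\rtimes \mathrm{Spin}(d-1,1)$ of the Poincaré group or its $\mathbb{Z}_2$ quotient by fermion parity $-1$, or (with $d\ge 1$) the identity component $\mathrm{Spin}(d,2)$ of the conformal group or its $\mathbb{Z}_2$ quotient by fermion parity $-1$. Here $\mathrm{Spin}(p,q)$ denotes the connected double cover of the identity component of $SO(p,q)$. 2. $G_I$ is compact. 3. The conclusion of the Coleman–Mandula theorem holds at the level of Lie algebras: $\mathrm{Lie}(G)$ is the direct sum, as a vector space, of a Lie subalgebra $\mathfrak{s}$ that is isomorphic to the Poincaré algebra or to the conformal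 algebra $\mathfrak{so}(d,2)$ and contains $\mathrm{Lie}(\hat G_0)$, and of the internal Lie algebra $\mathrm{Lie}(G_I)$, and $[\mathfrak{s},\mathrm{Lie}(G_I)]=0$. Then every element of $G_I$, including those outside the identity component of $G$, commutes with every element of $\hat G_0$: with all translations, boosts and rotations, and, in the conformal case, with dilations and special conformal transformations. -/

import Mathlib

open scoped Manifold ContDiff Topology Distributions LinearAlgebra.Projectivization

noncomputable section

namespace QFT

/-! ### Minkowski space and its causal structure -/

/-- The points of `d`-dimensional Minkowski space; the coordinate with index `0` is time. -/
abbrev Spacetime (d : ℕ) : Type := Fin d → ℝ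

/-- The weights `-1, 1, …, 1` of the Minkowski metric in the mostly-plus convention. -/
def minkowskiWeight (d : ℕ) [NeZero d] (i : Fin d) : ℝ := if i = 0 then -1 else 1

/-- The Minkowski metric `-(x⁰)² + (x¹)² + … + (x^(d-1))²`. -/
def minkowskiForm (d : ℕ) [NeZero d] : QuadraticForm ℝ (Spacetime d) :=
  QuadraticMap.weightedSumSquares ℝ (minkowskiWeight d)

/-- Inextendible causal curves, parametrised by the time coordinate. -/
def IsCausalCurve {d : ℕ} [NeZero d] (γ : ℝ → Spacetime d) : Prop :=
  (∀ t, γ t 0 = t) ∧ ∀ s t, minkowskiForm d (γ t - γ s) ≤ 0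

/-- Inextendible timelike curves, parametrised by the time coordinate. -/
def IsTimelikeCurve {d : ℕ} [NeZero d] (γ : ℝ → Spacetime d) : Prop :=
  (∀ t, γ t 0 = t) ∧ ∀ s t, s ≠ t → minkowskiForm d (γ t - γ s) < 0

/-- A Cauchy slice is met exactly once by every inextendible timelike curve. -/
def IsCauchySlice {d : ℕ} [NeZero d] (S : Set (Spacetime d)) : Prop :=
  ∀ γ : ℝ → Spacetime d, IsTimelikeCurve γ → ∃! t, γ t ∈ S

/-- A spatial region: a (relatively open) subregion of a Cauchy slice. -/
def IsRegion {d : ℕ} [NeZero d] (R : Set (Spacetime d)) : Prop :=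
  ∃ S O : Set (Spacetime d), IsCauchySlice S ∧ IsOpen O ∧ R = S ∩ O

/-- The domain of dependence `D[R]`: every inextendible causal curve through the point meets
`R`. -/
def domainOfDependence {d : ℕ} [NeZero d] (R : Set (Spacetime d)) : Set (Spacetime d) :=
  {x | ∀ γ : ℝ → Spacetime d, IsCausalCurve γ → x ∈ Set.range γ → ∃ t, γ t ∈ R}

/-- Every point of `R` is spacelike separated from every point of `R'`. -/
def SpacelikeSeparated {d : ℕ} [NeZero d] (R R' : Set (Spacetime d)) : Prop :=
  ∀ x ∈ R, ∀ y ∈ R', 0 < minkowskiForm d (x - y)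

/-! ### Operators on a Hilbert space -/

section Hilbert

variable (H : Type*) [NormedAddCommGroup H] [InnerProductSpace ℂ H]

/-- The group of all unitary and antiunitary operators on `H`. -/
def unitaryOrAntiunitary : Subgroup (H ≃ₗᵢ[ℝ] H) where
  carrier := {U | (∀ (c : ℂ) (v : H), U (c • v) = c • U v) ∨
    (∀ (c : ℂ) (v : H), U (c • v) = (starRingEnd ℂ) c • U v)}
  one_mem' := Or.inl fun _ _ => rfl
  mul_mem' := by
    rintro U V (hU | hU) (hV | hV)
    · exact Or.inl fun c v => by simp [LinearIsometryEquiv.coe_mul, hU, hV]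
    · exact Or.inr fun c v => by simp [LinearIsometryEquiv.coe_mul, hU, hV]
    · exact Or.inr fun c v => by simp [LinearIsometryEquiv.coe_mul, hU, hV]
    · exact Or.inl fun c v => by simp [LinearIsometryEquiv.coe_mul, hU, hV]
  inv_mem' := by
    rintro U (hU | hU)
    · refine Or.inl fun c v => U.injective ?_
      rw [hU]
      change U (U.symm _) = c • U (U.symm _)
      simp
    · refine Or.inr fun c v => U.injective ?_
      rw [hU]
      change U (U.symm _) = _ • U (U.symm _)
      simp

variable {H}

/-- The conjugated operator `U† O U`, for `U` unitary or antiunitary. -/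
def conjOp (U : unitaryOrAntiunitary H) (O : H →L[ℂ] H) : H →L[ℂ] H :=
  LinearMap.mkContinuous
    { toFun := fun v => (U : H ≃ₗᵢ[ℝ] H).symm (O ((U : H ≃ₗᵢ[ℝ] H) v))
      map_add' := fun v w => by simp
      map_smul' := fun c v => by
        apply (U : H ≃ₗᵢ[ℝ] H).injective
        rcases U.2 with h | h <;> simp [h] }
    ‖O‖ (fun v => by simpa using O.le_opNorm ((U : H ≃ₗᵢ[ℝ] H) v))

/-- The strong operator topology: the topology of pointwise convergence on `H`. -/
@[reducible] def strongOperatorTopology (H : Type*) [NormedAddCommGroup H] [InnerProductSpace ℂ H] :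
    TopologicalSpace (H →L[ℂ] H) :=
  TopologicalSpace.induced (fun O => (O : H → H)) inferInstance

/-- A closed operator is affiliated with a von Neumann algebra if it commutes with every element
of the commutant. -/
def IsAffiliated [CompleteSpace H] (T : H →ₗ.[ℂ] H) (A : VonNeumannAlgebra H) : Prop :=
  ∀ B ∈ A.commutant, ∀ v w : H, (v, w) ∈ T.graph → (B v, B w) ∈ T.graph

/-- A local operator: an operator-valued distribution on spacetime. Smearing with a real test
function yields a closed operator, all these operators share a dense core, and the matrix
elements between vectors of the core and of `H` are distributions. -/
structure LocalOperator (d : ℕ) (H : Type*) [NormedAddCommGroup H] [InnerProductSpace ℂ H] where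
  smear : 𝓓((⊤ : TopologicalSpace.Opens (Spacetime d)), ℝ) → (H →ₗ.[ℂ] H)
  isClosed_smear : ∀ h, (smear h).IsClosed
  core : Submodule ℂ H
  dense_core : Dense (core : Set H)
  hasCore : ∀ h, (smear h).HasCore core
  distribution : ∀ (v : core) (w : H),
    ∃ D : 𝓓'((⊤ : TopologicalSpace.Opens (Spacetime d)), ℂ),
      ∀ h, D h = inner ℂ w (smear h ⟨v, (hasCore h).le_domain v.2⟩)

end Hilbert

/-! ### Quantum field theories on Minkowski space -/

/-- A quantum field theory on `d`-dimensional Minkowski space in the algebraic approach: a Hilbert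
space `H`, von Neumann algebras `A[R]` attached to spatial regions, and local operators. -/
structure QuantumFieldTheory (d : ℕ) [NeZero d] (H : Type*) [NormedAddCommGroup H]
    [InnerProductSpace ℂ H] [CompleteSpace H] where
  algebra : Set (Spacetime d) → VonNeumannAlgebra H
  isotony : ∀ R R', IsRegion R → IsRegion R' → R ⊆ domainOfDependence R' →
    (algebra R : Set (H →L[ℂ] H)) ⊆ algebra R'
  /-- `(-1)^F`; bosonic operators commute with it and fermionic operators anticommute with it -/
  parity : H →L[ℂ] H
  parity_unitary : parity ∈ unitary (H →L[ℂ] H)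
  parity_sq : parity * parity = 1
  parity_conj : ∀ R, IsRegion R → ∀ A ∈ algebra R, parity * A * parity ∈ algebra R
  bosonic_commute : ∀ R R', IsRegion R → IsRegion R' → SpacelikeSeparated R R' →
    ∀ A ∈ algebra R, ∀ B ∈ algebra R', parity * A = A * parity → A * B = B * A
  fermionic_anticommute : ∀ R R', IsRegion R → IsRegion R' → SpacelikeSeparated R R' →
    ∀ A ∈ algebra R, ∀ B ∈ algebra R', parity * A = -(A * parity) → parity * B = -(B * parity) →
      A * B = -(B * A)
  localOperators : Set (LocalOperator d H)
  affiliated : ∀ φ ∈ localOperators, ∀ R, IsRegion R →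
    ∀ h : 𝓓((⊤ : TopologicalSpace.Opens (Spacetime d)), ℝ),
      tsupport (h : Spacetime d → ℝ) ⊆ domainOfDependence R → IsAffiliated (φ.smear h) (algebra R)

/-! ### Conformal transformations -/

/-- The weights of the quadratic form of signature `(d, 2)`. -/
def conformalWeight (d : ℕ) [NeZero d] : Fin d ⊕ Fin 2 → ℝ :=
  Sum.elim (minkowskiWeight d) ![1, -1]

/-- The quadratic form `x² + u² - v²` of signature `(d, 2)` on `ℝ^(d-1,1) ⊕ ℝ²`. -/
def conformalForm (d : ℕ) [NeZero d] : QuadraticForm ℝ (Fin d ⊕ Fin 2 → ℝ) :=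
  QuadraticMap.weightedSumSquares ℝ (conformalWeight d)

/-- The null vector `(x, (1 - x²)/2, (1 + x²)/2)` that represents a point `x` of Minkowski
space. -/
def nullLift {d : ℕ} [NeZero d] (x : Spacetime d) : Fin d ⊕ Fin 2 → ℝ :=
  Sum.elim x ![(1 - minkowskiForm d x) / 2, (1 + minkowskiForm d x) / 2]

lemma nullLift_ne_zero {d : ℕ} [NeZero d] (x : Spacetime d) : nullLift x ≠ 0 := by
  intro h
  have h0 := congrFun h (Sum.inr 0)
  have h1 := congrFun h (Sum.inr 1)
  simp [nullLift] at h0 h1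
  linarith

lemma conformalForm_nullLift {d : ℕ} [NeZero d] (x : Spacetime d) :
    conformalForm d (nullLift x) = 0 := by
  simp only [conformalForm, nullLift, conformalWeight, QuadraticMap.weightedSumSquares_apply,
    Fintype.sum_sum_type, Sum.elim_inl, Sum.elim_inr, Fin.sum_univ_two, minkowskiForm]
  simp
  ring

/-- The conformal compactification of Minkowski space: the projective null cone of the quadratic
form of signature `(d, 2)`. -/
def CompactifiedMinkowski (d : ℕ) [NeZero d] : Type :=
  {p : ℙ ℝ (Fin d ⊕ Fin 2 → ℝ) // conformalForm d p.rep = 0}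

/-- The point of the projective null cone spanned by a null vector. -/
def CompactifiedMinkowski.mk {d : ℕ} [NeZero d] (X : Fin d ⊕ Fin 2 → ℝ) (hX : X ≠ 0)
    (hnull : conformalForm d X = 0) : CompactifiedMinkowski d :=
  ⟨Projectivization.mk ℝ X hX, by
    obtain ⟨a, ha⟩ := Projectivization.exists_smul_eq_mk_rep ℝ X hX
    rw [← ha, Units.smul_def, QuadraticMap.map_smul, hnull, smul_zero]⟩

/-- The affine chart of the compactification obtained by moving Minkowski space with a linear
isometry of the form of signature `(d, 2)`. -/
def affineChart {d : ℕ} [NeZero d] (A : (conformalForm d).IsometryEquiv (conformalForm d))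
    (x : Spacetime d) : CompactifiedMinkowski d :=
  CompactifiedMinkowski.mk (A (nullLift x))
    (fun h => nullLift_ne_zero x (A.toLinearEquiv.injective (by simpa using h)))
    (by rw [A.map_app, conformalForm_nullLift])

/-- The space on which a group of conformal symmetries acts: Minkowski space itself, or (for
groups with special conformal transformations, which move points of Minkowski space to infinity)
its conformal compactification. -/
inductive Model : Type
  | minkowski
  | compactified

/-- The points of the model. -/
def Model.Points (K : Model) (d : ℕ) [NeZero d] : Type :=
  match K with
  | .minkowski => Spacetime d
  | .compactified => CompactifiedMinkowski d

/-- The inclusion of Minkowski space. -/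
def Model.embed (K : Model) (d : ℕ) [NeZero d] : Spacetime d → K.Points d :=
  match K with
  | .minkowski => id
  | .compactified => affineChart (QuadraticMap.IsometryEquiv.refl (conformalForm d))

/-- The charts that define the conformal structure: the identity of Minkowski space, resp. all
affine charts of the compactification. -/
def Model.charts (K : Model) (d : ℕ) [NeZero d] : Set (Spacetime d → K.Points d) :=
  match K with
  | .minkowski => {id}
  | .compactified => Set.range affineChart

/-! ### Spin groups, the Poincaré group and the conformal group -/

section Spin

variable {M : Type*} [AddCommGroup M] [Module ℝ M]

/-- The left inverse of the inclusion of vectors into the Clifford algebra. -/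
def vectorPart (Q : QuadraticForm ℝ M) : CliffordAlgebra Q →ₗ[ℝ] M :=
  ExteriorAlgebra.ιInv ∘ₗ (CliffordAlgebra.equivExterior Q).toLinearMap

lemma vectorPart_ι (Q : QuadraticForm ℝ M) (v : M) :
    vectorPart Q (CliffordAlgebra.ι Q v) = v := by
  simp only [vectorPart, LinearMap.comp_apply, LinearEquiv.coe_coe, CliffordAlgebra.equivExterior,
    CliffordAlgebra.changeFormEquiv_apply, CliffordAlgebra.changeForm_ι]
  exact ExteriorAlgebra.ι_leftInverse v

/-- The vector `x v x⁻¹`. -/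
def spinActFun (Q : QuadraticForm ℝ M) (x : spinGroup Q) : M →ₗ[ℝ] M where
  toFun v := vectorPart Q (x * CliffordAlgebra.ι Q v * star (x : CliffordAlgebra Q))
  map_add' v w := by simp [mul_add, add_mul]
  map_smul' c v := by simp

lemma ι_spinActFun (Q : QuadraticForm ℝ M) (x : spinGroup Q) (v : M) :
    CliffordAlgebra.ι Q (spinActFun Q x v) =
      x * CliffordAlgebra.ι Q v * star (x : CliffordAlgebra Q) := by
  have h := spinGroup.conjAct_smul_ι_mem_range_ι (Q := Q) (x := spinGroup.toUnits x) x.2 v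
  obtain ⟨w, hw⟩ := h
  rw [ConjAct.units_smul_def, ConjAct.ofConjAct_toConjAct] at hw
  have hw' : CliffordAlgebra.ι Q w =
      x * CliffordAlgebra.ι Q v * star (x : CliffordAlgebra Q) := hw
  change CliffordAlgebra.ι Q (vectorPart Q _) = _
  rw [← hw', vectorPart_ι]

lemma ι_injective (Q : QuadraticForm ℝ M) : Function.Injective (CliffordAlgebra.ι Q) :=
  Function.LeftInverse.injective (vectorPart_ι Q)

lemma spinActFun_mul (Q : QuadraticForm ℝ M) (x y : spinGroup Q) (v : M) :
    spinActFun Q (x * y) v = spinActFun Q x (spinActFun Q y v) := by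
  apply ι_injective Q
  simp [ι_spinActFun, mul_assoc]

lemma spinActFun_one (Q : QuadraticForm ℝ M) (v : M) : spinActFun Q 1 v = v := by
  apply ι_injective Q
  simp [ι_spinActFun]

/-- The vector representation of the spin group, `v ↦ x v x⁻¹`. Over a real form that is not
definite, `spinGroup Q` consists of the even products of unit vectors with an even number of
factors of each sign, so that it is the double cover of the identity component of the special
orthogonal group (and connected as soon as the form has two directions of the same sign). -/
def spinAct (Q : QuadraticForm ℝ M) : spinGroup Q →* (M ≃ₗ[ℝ] M) where
  toFun x := LinearEquiv.ofLinearMap (spinActFun Q x) (spinActFun Q x⁻¹)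
    (by ext v; simp [← spinActFun_mul, spinActFun_one])
    (by ext v; simp [← spinActFun_mul, spinActFun_one])
  map_one' := by ext v; exact spinActFun_one Q v
  map_mul' x y := by ext v; exact spinActFun_mul Q x y v

/-- The action of the spin group on the additive group of vectors. -/
def spinMulAut (Q : QuadraticForm ℝ M) : spinGroup Q →* MulAut (Multiplicative M) where
  toFun x := AddEquiv.toMultiplicative (spinAct Q x).toAddEquiv
  map_one' := by ext v; simp
  map_mul' x y := by ext v; simp

/-- A smooth curve in the spin group: smooth in every linear coordinate of the (finite-dimensional)
Clifford algebra. -/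
def IsSmoothSpinCurve {Q : QuadraticForm ℝ M} (σ : ℝ → spinGroup Q) : Prop :=
  ∀ l : Module.Dual ℝ (CliffordAlgebra Q), ContDiff ℝ ∞ (fun t => l (σ t))

end Spin

/-- The identity component `ℝ^d ⋊ Spin(d-1,1)` of the Poincaré group (`d ≥ 3`). -/
abbrev PoincareSpin (d : ℕ) [NeZero d] : Type :=
  Multiplicative (Spacetime d) ⋊[spinMulAut (minkowskiForm d)] spinGroup (minkowskiForm d)

/-- The identity component `Spin(d,2)` of the conformal group. -/
abbrev ConformalSpin (d : ℕ) [NeZero d] : Type := spinGroup (conformalForm d)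

attribute [local instance 100] LieRing.ofAssociativeRing

/-- The conformal Lie algebra `so(d,2)`. -/
abbrev ConformalLieAlgebra (d : ℕ) [NeZero d] :
    LieSubalgebra ℝ (Matrix (Fin d ⊕ Fin 2) (Fin d ⊕ Fin 2) ℝ) :=
  skewAdjointMatricesLieSubalgebra (Matrix.diagonal (conformalWeight d))

/-- The Poincaré Lie algebra, as the matrices with blocks `(Λ, a; 0, 0)`, `Λ ∈ so(d-1,1)`,
`a ∈ ℝ^d`. -/
def PoincareLieAlgebra (d : ℕ) [NeZero d] :
    LieSubalgebra ℝ (Matrix (Fin d ⊕ Unit) (Fin d ⊕ Unit) ℝ) where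
  carrier := {X | X.toBlocks₁₁ ∈
      skewAdjointMatricesLieSubalgebra (Matrix.diagonal (minkowskiWeight d)) ∧
    X.toBlocks₂₁ = 0 ∧ X.toBlocks₂₂ = 0}
  zero_mem' := ⟨zero_mem _, rfl, rfl⟩
  add_mem' := by
    rintro X Y ⟨h1, h2, h3⟩ ⟨k1, k2, k3⟩
    refine ⟨add_mem h1 k1, ?_, ?_⟩
    · change X.toBlocks₂₁ + Y.toBlocks₂₁ = 0
      rw [h2, k2, add_zero]
    · change X.toBlocks₂₂ + Y.toBlocks₂₂ = 0
      rw [h3, k3, add_zero]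
  smul_mem' := by
    rintro c X ⟨h1, h2, h3⟩
    refine ⟨Submodule.smul_mem _ c h1, ?_, ?_⟩
    · change c • X.toBlocks₂₁ = 0
      rw [h2, smul_zero]
    · change c • X.toBlocks₂₂ = 0
      rw [h3, smul_zero]
  lie_mem' := by
    rintro X Y ⟨h1, h2, h3⟩ ⟨k1, k2, k3⟩
    rw [← Matrix.fromBlocks_toBlocks X, ← Matrix.fromBlocks_toBlocks Y, h2, h3, k2, k3]
    have := LieSubalgebra.lie_mem _ h1 k1
    simpa [LieRing.of_associative_ring_bracket, Matrix.fromBlocks_multiply,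
      sub_eq_add_neg, Matrix.fromBlocks_neg, Matrix.fromBlocks_add] using this

/-! ### Lie groups and their Lie algebras -/

section LieGroups

variable {E : Type*} [NormedAddCommGroup E] [NormedSpace ℝ E]
  {G : Type*} [TopologicalSpace G] [ChartedSpace E G] [Group G]

/-- A smooth Lie group has the regularity needed for the Lie bracket on its Lie algebra. -/
instance [LieGroup 𝓘(ℝ, E) ∞ G] : LieGroup 𝓘(ℝ, E) (minSmoothness ℝ 3) G := by
  rw [minSmoothness_of_isRCLikeNormedField]
  infer_instance

/-- The Lie algebra of a Lie subgroup `P`, as a subset of the Lie algebra of `G`: the velocities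
at the identity of the smooth curves in `G` that run in `P`. -/
def lieAlgebraOf (P : Subgroup G) : Set (GroupLieAlgebra 𝓘(ℝ, E) G) :=
  {X | ∃ γ : ℝ → G, ContMDiff 𝓘(ℝ, ℝ) 𝓘(ℝ, E) ∞ γ ∧ γ 0 = 1 ∧ (∀ t, γ t ∈ P) ∧
    (mfderiv 𝓘(ℝ, ℝ) 𝓘(ℝ, E) γ 0 (1 : ℝ) : E) = X}

/-- A group of conformal transformations of `X` that is smooth, jointly in the group element and
the point: in all charts, where it is defined, it is given by a smooth map whose derivative
multiplies the metric by a positive factor. -/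
def IsSmoothConformalAction {d : ℕ} [NeZero d] (E : Type*) [NormedAddCommGroup E]
    [NormedSpace ℝ E] {G : Type*} [TopologicalSpace G] [ChartedSpace E G] [Group G] {X : Type}
    (charts : Set (Spacetime d → X)) (f : G →* Equiv.Perm X) : Prop :=
  ∀ c ∈ charts, ∀ c' ∈ charts, ∀ (g₀ : G) (x₀ y₀ : Spacetime d), f g₀ (c x₀) = c' y₀ →
    ∃ F : G × Spacetime d → Spacetime d,
      ContMDiffAt (𝓘(ℝ, E).prod 𝓘(ℝ, Spacetime d)) 𝓘(ℝ, Spacetime d) ∞ F (g₀, x₀) ∧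
      (∀ᶠ p in 𝓝 (g₀, x₀), f p.1 (c p.2) = c' (F p)) ∧
      ∃ Ω : ℝ, 0 < Ω ∧ ∀ v : Spacetime d,
        minkowskiForm d (fderiv ℝ (fun x => F (g₀, x)) x₀ v) = Ω * minkowskiForm d v

end LieGroups

/-! ### Global symmetries -/

/-- A (spacetime) global symmetry with symmetry group `G` of a quantum field theory. No condition
is imposed on how the stress tensor transforms. -/
structure GlobalSymmetry {d : ℕ} [NeZero d] {H : Type*} [NormedAddCommGroup H]
    [InnerProductSpace ℂ H] [CompleteSpace H] (T : QuantumFieldTheory d H) (K : Model)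
    (E : Type*) [NormedAddCommGroup E] [NormedSpace ℝ E]
    (G : Type*) [TopologicalSpace G] [ChartedSpace E G] [Group G] where
  /-- the symmetry operators -/
  U : G →* unitaryOrAntiunitary H
  /-- the conformal transformations `f_g` -/
  f : G →* Equiv.Perm (K.Points d)
  smooth_conformal : IsSmoothConformalAction E (K.charts d) f
  /-- `U†(g) A[R] U(g) = A[f_{g⁻¹}(R)]`, for all regions that `f_{g⁻¹}` keeps within Minkowski
  space -/
  covariant : ∀ (g : G) (R R' : Set (Spacetime d)), IsRegion R → IsRegion R' →
    K.embed d '' R' = f g⁻¹ '' (K.embed d '' R) →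
    f g⁻¹ '' (K.embed d '' domainOfDependence R) ⊆ Set.range (K.embed d) →
    conjOp (U g) '' (T.algebra R : Set (H →L[ℂ] H)) = (T.algebra R' : Set (H →L[ℂ] H))
  /-- joint continuity in the strong operator topology of `(g, O) ↦ U†(g) O U(g)`, on uniformly
  bounded sets of operators in a bounded region -/
  continuous_conj : ∀ R : Set (Spacetime d), IsRegion R → Bornology.IsBounded R →
    ∀ B ⊆ (T.algebra R : Set (H →L[ℂ] H)), (∃ C : ℝ, ∀ O ∈ B, ‖O‖ ≤ C) →
      @ContinuousOn (G × (H →L[ℂ] H)) (H →L[ℂ] H)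
        (@instTopologicalSpaceProd G (H →L[ℂ] H) _ (strongOperatorTopology H))
        (strongOperatorTopology H) (fun p => conjOp (U p.1) p.2) (Set.univ ×ˢ B)
  /-- every element other than the identity changes some local operator, `U† φ U ≠ φ` -/
  faithful : ∀ g : G, g ≠ 1 → ∃ φ ∈ T.localOperators,
    ∃ h : 𝓓((⊤ : TopologicalSpace.Opens (Spacetime d)), ℝ), ¬ ∀ v w : H,
      ((U g : H ≃ₗᵢ[ℝ] H) v, (U g : H ≃ₗᵢ[ℝ] H) w) ∈ (φ.smear h).graph ↔ (v, w) ∈ (φ.smear h).graph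

namespace GlobalSymmetry

variable {d : ℕ} [NeZero d] {H : Type*} [NormedAddCommGroup H] [InnerProductSpace ℂ H]
  [CompleteSpace H] {T : QuantumFieldTheory d H} {K : Model}
  {E : Type*} [NormedAddCommGroup E] [NormedSpace ℝ E]
  {G : Type*} [TopologicalSpace G] [ChartedSpace E G] [Group G]

/-- The internal subgroup `G_I`: the elements `g` for which `f_g` is the identity. -/
def internal (S : GlobalSymmetry T K E G) : Subgroup G := S.f.ker

/-- `P` is the identity component of the Poincaré group, or its quotient by fermion parity,
contained in `G` as a Lie subgroup: the image of `ℝ^d ⋊ Spin(d-1,1)` under a smooth homomorphism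
that is injective up to fermion parity `-1`, and whose elements act on spacetime in the standard
way. -/
def IsPoincareIdentityComponent (S : GlobalSymmetry T K E G) (P : Subgroup G) : Prop :=
  ∃ j : PoincareSpin d →* G, j.range = P ∧
    (∀ p, j p = 1 → p.left = 1 ∧
      ((p.right : CliffordAlgebra (minkowskiForm d)) = 1 ∨
        (p.right : CliffordAlgebra (minkowskiForm d)) = -1)) ∧
    (∀ a : ℝ → Spacetime d, ContDiff ℝ ∞ a →
      ∀ σ : ℝ → spinGroup (minkowskiForm d), IsSmoothSpinCurve σ →
        ContMDiff 𝓘(ℝ, ℝ) 𝓘(ℝ, E) ∞ (fun t => j ⟨Multiplicative.ofAdd (a t), σ t⟩)) ∧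
    ∀ p (x : Spacetime d), S.f (j p) (K.embed d x) =
      K.embed d (spinAct (minkowskiForm d) p.right x + Multiplicative.toAdd p.left)

/-- `P` is the identity component of the conformal group, or its quotient by fermion parity,
contained in `G` as a Lie subgroup: the image of `Spin(d,2)` under a smooth homomorphism that is
injective up to fermion parity `-1`, and whose elements act on spacetime in the standard way,
i.e. through the linear action on null vectors. -/
def IsConformalIdentityComponent (S : GlobalSymmetry T K E G) (P : Subgroup G) : Prop :=
  ∃ j : ConformalSpin d →* G, j.range = P ∧
    (∀ p, j p = 1 → (p : CliffordAlgebra (conformalForm d)) = 1 ∨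
      (p : CliffordAlgebra (conformalForm d)) = -1) ∧
    (∀ σ : ℝ → ConformalSpin d, IsSmoothSpinCurve σ →
      ContMDiff 𝓘(ℝ, ℝ) 𝓘(ℝ, E) ∞ (fun t => j (σ t))) ∧
    ∀ p (x y : Spacetime d),
      (∃ r : ℝ, spinAct (conformalForm d) p (nullLift x) = r • nullLift y) →
        S.f (j p) (K.embed d x) = K.embed d y

/-- The conclusion of the Coleman–Mandula theorem at the level of Lie algebras: the Lie algebra of
`G` is the direct sum of a Poincaré or conformal algebra `s`, which contains the generators of `P`,
and the Lie algebra `i` of the internal subgroup, all of whose elements commute with `s`. -/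
def ColemanMandula [LieGroup 𝓘(ℝ, E) ∞ G] [CompleteSpace E] (S : GlobalSymmetry T K E G)
    (P : Subgroup G) : Prop :=
  ∃ s i : LieSubalgebra ℝ (GroupLieAlgebra 𝓘(ℝ, E) G),
    (Nonempty (s ≃ₗ⁅ℝ⁆ PoincareLieAlgebra d) ∨ Nonempty (s ≃ₗ⁅ℝ⁆ ConformalLieAlgebra d)) ∧
    lieAlgebraOf P ⊆ (s : Set (GroupLieAlgebra 𝓘(ℝ, E) G)) ∧
    (i : Set (GroupLieAlgebra 𝓘(ℝ, E) G)) = lieAlgebraOf S.internal ∧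
    IsCompl s.toSubmodule i.toSubmodule ∧
    ∀ x ∈ s, ∀ y ∈ i, ⁅x, y⁆ = 0

end GlobalSymmetry

end QFT

end

/-!
Let `h` be an internal symmetry and `j` the homomorphism from the Poincaré or conformal spin group
`Γ` to `G`. The defect `φ γ = h j(γ) h⁻¹ j(γ)⁻¹` lies in the internal subgroup, which is normal and
compact. The theorem says that `φ` is trivial. It is proved by a contraction argument on group
elements that needs no structure theory of Lie algebras.

* The Lie algebras of `P` and of the internal subgroup commute. The derivative of `Ad (γ t) Y` along
  a curve `γ` is a Lie bracket (`deriv_adjoint_eq_lieBracket`), so curves in `P` fix the internal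
  Lie algebra (`adjointMap_eq_self`) and therefore commute with curves in the internal subgroup
  (`commute_of_adjointMap_eq_self`). If `x` is a smooth curve in `Γ` through the identity, then
  `φ ∘ x` is such a curve. As `Γ` is generated by smooth curves, the values of `φ` centralize `P`,
  and then `φ` is a homomorphism (`exists_commutatorHom`).

* `Γ` is generated by null rotations `1 + t n u`, where `n` is null and `u` is orthogonal to `n`
  (and by translations along null vectors, for the Poincaré group). Indeed null rotations act
  transitively, up to sign, on the vectors of any given nonzero length, so that the quotient of two
  such vectors in the Clifford algebra is a product of null rotations
  (`IsHyperbolicTriple.nullEquiv`); an element of the spin group is an even product of vectors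
  (`IsHyperbolicTriple.mem_nullRotations_of_mem_spinGroup`).

* A boost `a` that scales `n` by `1/4` contracts these curves: `a x(t) a⁻¹ = x(t/4)`
  (`nullCurves_contracted`, `poincareNullCurves_contracted`). Hence
  `φ(a)ᵏ φ(x t) φ(a)⁻ᵏ = φ(x (t/4ᵏ))` tends to `1`, while `φ(a)ᵏ` stays in a compact group. At a
  cluster point of `φ(a)ᵏ` this gives `φ(x t) = 1` (`eq_one_of_tendsto_conj_pow`).

The three steps are joined in `commute_of_contracted_curves`.
-/

noncomputable section

namespace QFT

/-! ### The bracket of a multiplication near its unit -/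

section PartialDerivatives

variable {E : Type*} [NormedAddCommGroup E] [NormedSpace ℝ E]

lemma eventually_fderiv_prodMk_left {E' : Type*} [NormedAddCommGroup E'] [NormedSpace ℝ E']
    {F : E' × E → E} {p₀ : E' × E} (hF : ContDiffAt ℝ ∞ F p₀) :
    ∀ᶠ p in 𝓝 p₀, ∀ v, fderiv ℝ (fun w => F (p.1, w)) p.2 v = fderiv ℝ F p (0, v) := by
  have h1 : ContDiffAt ℝ 1 F p₀ := hF.of_le (by norm_cast)
  filter_upwards [h1.eventually (by simp)] with p hp v
  have hd : HasFDerivAt F (fderiv ℝ F p) (p.1, p.2) := (hp.differentiableAt (by simp)).hasFDerivAt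
  have := (hd.comp (f := fun e => (p.1, e)) p.2 (hasFDerivAt_prodMk_right p.1 p.2)).fderiv
  simp only [Function.comp_def] at this
  rw [this]; simp

lemma eventually_fderiv_prodMk_right {F : E × E → E} {p₀ : E × E} (hF : ContDiffAt ℝ ∞ F p₀) :
    ∀ᶠ p in 𝓝 p₀, ∀ v, fderiv ℝ (fun w => F (w, p.2)) p.1 v = fderiv ℝ F p (v, 0) := by
  have h1 : ContDiffAt ℝ 1 F p₀ := hF.of_le (by norm_cast)
  filter_upwards [h1.eventually (by simp)] with p hp v
  have hd : HasFDerivAt F (fderiv ℝ F p) (p.1, p.2) := (hp.differentiableAt (by simp)).hasFDerivAt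
  have := (hd.comp (f := fun e => (e, p.2)) p.1 (hasFDerivAt_prodMk_left p.1 p.2)).fderiv
  simp only [Function.comp_def] at this
  rw [this]; simp

/-- If `F` is a smooth multiplication with unit `z`, and `η t` is the vector `Y` conjugated
by `c t`, expressed through `c t * y = (c t * y * (c t)⁻¹) * c t`, then the velocity of `η` is the
bracket of the left-invariant fields of `X = c' 0` and `Y`. -/
lemma deriv_adjoint_eq_lieBracket {F : E × E → E} {z : E} (hF : ContDiffAt ℝ ∞ F (z, z))
    (hunit : ∀ᶠ w in 𝓝 z, F (w, z) = w) (hunit' : ∀ᶠ w in 𝓝 z, F (z, w) = w)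
    {c η : ℝ → E} {X Y : E} (hc : HasDerivAt c X 0) (hc0 : c 0 = z)
    (hη : DifferentiableAt ℝ η 0) (hη0 : η 0 = Y)
    (hrel : ∀ᶠ t in 𝓝 (0 : ℝ), fderiv ℝ (fun w => F (c t, w)) z Y
      = fderiv ℝ (fun w => F (w, c t)) z (η t)) :
    deriv η 0 = VectorField.lieBracket ℝ (fun u => fderiv ℝ (fun w => F (u, w)) z X)
      (fun u => fderiv ℝ (fun w => F (u, w)) z Y) z := by
  set D := fderiv ℝ F with hD
  have hDd : HasFDerivAt D (fderiv ℝ D (z, z)) (z, z) :=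
    ((hF.fderiv_right (m := 1) (by norm_cast)).differentiableAt (by simp)).hasFDerivAt
  have hsymm : ∀ u v, fderiv ℝ D (z, z) u v = fderiv ℝ D (z, z) v u := fun u v =>
    (hF.isSymmSndFDerivAt (by
      simp only [minSmoothness_of_isRCLikeNormedField]
      exact WithTop.coe_le_coe.2 (le_top : (2 : ℕ∞) ≤ ⊤))).eq u v
  have hD0 : ∀ v, D (z, z) (v, 0) = v := by
    intro v
    rw [← (eventually_fderiv_prodMk_right hF).self_of_nhds v]
    have : (fun w => F (w, z)) =ᶠ[𝓝 z] id := hunit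
    simp only [this.fderiv_eq, fderiv_id]; rfl
  have hL0 : ∀ v, fderiv ℝ (fun w => F (z, w)) z v = v := by
    intro v
    have : (fun w => F (z, w)) =ᶠ[𝓝 z] id := hunit'
    simp only [this.fderiv_eq, fderiv_id]; rfl
  have hL : ∀ V : E, (fun u => fderiv ℝ (fun w => F (u, w)) z V) =ᶠ[𝓝 z]
      fun u => D (u, z) (0, V) := by
    intro V
    have : Filter.Tendsto (fun u : E => (u, z)) (𝓝 z) (𝓝 (z, z)) :=
      (Continuous.tendsto (by fun_prop) z)
    exact (this.eventually (eventually_fderiv_prodMk_left hF)).mono fun u hu => hu V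
  have hLd : ∀ V u, fderiv ℝ (fun u => fderiv ℝ (fun w => F (u, w)) z V) z u
      = fderiv ℝ D (z, z) (u, 0) (0, V) := by
    intro V u
    rw [(hL V).fderiv_eq]
    have h1 := hDd.comp (f := fun e => (e, z)) z (hasFDerivAt_prodMk_left z z)
    have h2 := h1.clm_apply (hasFDerivAt_const ((0, V) : E × E) z)
    simp only [Function.comp_def] at h2
    rw [h2.fderiv]; simp
  have hct : Filter.Tendsto c (𝓝 0) (𝓝 z) := hc0 ▸ hc.continuousAt.tendsto
  have hrel' : (fun t => D (c t, z) (0, Y)) =ᶠ[𝓝 0] fun t => D (z, c t) (η t, 0) := by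
    have h1 : Filter.Tendsto (fun t => (z, c t)) (𝓝 0) (𝓝 (z, z)) := by
      rw [nhds_prod_eq]; exact tendsto_const_nhds.prodMk hct
    filter_upwards [hrel, hct.eventually (hL Y),
      h1.eventually (eventually_fderiv_prodMk_right hF)] with t h2 h3 h4
    rw [← h3, h2, h4]
  have hl : HasDerivAt (fun t => D (c t, z) (0, Y)) (fderiv ℝ D (z, z) (X, 0) (0, Y)) 0 := by
    have h1 : HasDerivAt (fun t => (c t, z)) (X, 0) 0 := hc.prodMk (hasDerivAt_const 0 z)
    have h2 := (show HasFDerivAt D (fderiv ℝ D (z, z)) (c 0, z) by rwa [hc0]).comp_hasDerivAt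
      (f := fun t => (c t, z)) 0 h1
    simpa [hc0] using h2.clm_apply (hasDerivAt_const (0 : ℝ) ((0, Y) : E × E))
  have hr : HasDerivAt (fun t => D (z, c t) (η t, 0))
      (fderiv ℝ D (z, z) (0, X) (Y, 0) + deriv η 0) 0 := by
    have h1 : HasDerivAt (fun t => (z, c t)) (0, X) 0 := (hasDerivAt_const 0 z).prodMk hc
    have h2 := (show HasFDerivAt D (fderiv ℝ D (z, z)) (z, c 0) by rwa [hc0]).comp_hasDerivAt
      (f := fun t => (z, c t)) 0 h1
    have h3 := h2.clm_apply (hη.hasDerivAt.prodMk (hasDerivAt_const 0 (0 : E)))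
    simpa [hc0, hη0, hD0] using h3
  have key := hl.unique (hr.congr_of_eventuallyEq hrel')
  rw [VectorField.lieBracket, hLd, hLd, hL0, hL0, key, hsymm (Y, 0)]
  abel

end PartialDerivatives

/-! ### The adjoint action in the chart at the identity -/

section UnitChart

variable {E : Type*} [NormedAddCommGroup E] [NormedSpace ℝ E]
  {G : Type*} [TopologicalSpace G] [ChartedSpace E G] [Group G]

variable (E G) in
/-- The preferred chart of a Lie group at the identity. -/
def unitChart : PartialEquiv G E := extChartAt 𝓘(ℝ, E) (1 : G)

variable (E G) in
/-- The multiplication of a Lie group, read in the chart at the identity. -/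
def chartMul (p : E × E) : E :=
  unitChart E G ((unitChart E G).symm p.1 * (unitChart E G).symm p.2)

/-- The adjoint action of `g` on the tangent space at the identity, computed in the chart. -/
def adjointMap (E : Type*) [NormedAddCommGroup E] [NormedSpace ℝ E]
    {G : Type*} [TopologicalSpace G] [ChartedSpace E G] [Group G] (g : G) : E →L[ℝ] E :=
  fderiv ℝ (fun w => unitChart E G (g * (unitChart E G).symm w * g⁻¹)) (unitChart E G 1)

@[simp]
lemma unitChart_symm_one : (unitChart E G).symm (unitChart E G 1) = 1 :=
  extChartAt_to_inv (I := 𝓘(ℝ, E)) (1 : G)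

lemma eventually_unitChart_symm_unitChart {α : Type*} {l : Filter α} {f : α → G}
    (hf : Filter.Tendsto f l (𝓝 1)) :
    ∀ᶠ a in l, (unitChart E G).symm (unitChart E G (f a)) = f a :=
  (hf.eventually (extChartAt_source_mem_nhds (I := 𝓘(ℝ, E)) (1 : G))).mono fun _ ha =>
    (unitChart E G).left_inv ha

lemma eventually_unitChart_unitChart_symm :
    ∀ᶠ w in 𝓝 (unitChart E G 1), unitChart E G ((unitChart E G).symm w) = w :=
  (extChartAt_target_mem_nhds (I := 𝓘(ℝ, E)) (1 : G)) |> Filter.mem_of_superset <| fun _ ha =>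
    (unitChart E G).right_inv ha

lemma chartMul_unit : ∀ᶠ w in 𝓝 (unitChart E G 1), chartMul E G (w, unitChart E G 1) = w := by
  filter_upwards [eventually_unitChart_unitChart_symm (E := E) (G := G)] with w hw
  simpa [chartMul] using hw

lemma chartMul_unit' : ∀ᶠ w in 𝓝 (unitChart E G 1), chartMul E G (unitChart E G 1, w) = w := by
  filter_upwards [eventually_unitChart_unitChart_symm (E := E) (G := G)] with w hw
  simpa [chartMul] using hw

variable [LieGroup 𝓘(ℝ, E) ∞ G]

lemma contMDiffAt_unitChart_symm :
    ContMDiffAt 𝓘(ℝ, E) 𝓘(ℝ, E) ∞ (unitChart E G).symm (unitChart E G 1) := by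
  have : IsManifold 𝓘(ℝ, E) ∞ G := inferInstance
  exact (contMDiffOn_extChartAt_symm (1 : G)).contMDiffAt (extChartAt_target_mem_nhds (1 : G))

lemma contMDiffAt_unitChart {N : Type*} [TopologicalSpace N] {E' H' : Type*}
    [NormedAddCommGroup E'] [NormedSpace ℝ E'] [TopologicalSpace H']
    {I' : ModelWithCorners ℝ E' H'} [ChartedSpace H' N] {f : N → G} {x : N}
    (hf : ContMDiffAt I' 𝓘(ℝ, E) ∞ f x) (hx : f x = 1) :
    ContMDiffAt I' 𝓘(ℝ, E) ∞ (fun y => unitChart E G (f y)) x := by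
  have : IsManifold 𝓘(ℝ, E) ∞ G := inferInstance
  have h : ContMDiffAt 𝓘(ℝ, E) 𝓘(ℝ, E) ∞ (unitChart E G) (f x) := hx ▸ contMDiffAt_extChartAt
  exact h.comp x hf

lemma contDiffAt_chartMul :
    ContDiffAt ℝ ∞ (chartMul E G) (unitChart E G 1, unitChart E G 1) := by
  rw [← contMDiffAt_iff_contDiffAt]
  apply contMDiffAt_unitChart
  · apply ContMDiffAt.mul
    · exact ContMDiffAt.comp (g := (unitChart E G).symm) (f := Prod.fst)
        (unitChart E G 1, unitChart E G 1) contMDiffAt_unitChart_symm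
        contDiff_fst.contMDiff.contMDiffAt
    · exact ContMDiffAt.comp (g := (unitChart E G).symm) (f := Prod.snd)
        (unitChart E G 1, unitChart E G 1) contMDiffAt_unitChart_symm
        contDiff_snd.contMDiff.contMDiffAt
  · simp

lemma contMDiffAt_conj (g : G) :
    ContMDiffAt 𝓘(ℝ, E) 𝓘(ℝ, E) ∞ (fun w => g * (unitChart E G).symm w * g⁻¹)
      (unitChart E G 1) :=
  (contMDiffAt_const.mul contMDiffAt_unitChart_symm).mul contMDiffAt_const

lemma hasFDerivAt_adjointMap (g : G) :
    HasFDerivAt (fun w => unitChart E G (g * (unitChart E G).symm w * g⁻¹)) (adjointMap E g)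
      (unitChart E G 1) := by
  have h := contMDiffAt_unitChart (contMDiffAt_conj (E := E) g) (by simp)
  exact ((contMDiffAt_iff_contDiffAt.1 h).differentiableAt (by simp)).hasFDerivAt

lemma tendsto_conj (g : G) : Filter.Tendsto (fun w => g * (unitChart E G).symm w * g⁻¹)
      (𝓝 (unitChart E G 1)) (𝓝 1) := by
  simpa using (contMDiffAt_conj (E := E) g).continuousAt.tendsto

lemma adjointMap_mul (g h : G) :
    adjointMap E (g * h) = (adjointMap E g).comp (adjointMap E h) := by
  have h1 := hasFDerivAt_adjointMap (E := E) h
  have h2 := hasFDerivAt_adjointMap (E := E) g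
  have h3 := (show HasFDerivAt _ _ (unitChart E G (h * (unitChart E G).symm (unitChart E G 1) *
    h⁻¹)) by simpa using h2).comp (unitChart E G 1) h1
  refine HasFDerivAt.unique (hasFDerivAt_adjointMap (g * h)) (h3.congr_of_eventuallyEq ?_)
  filter_upwards [eventually_unitChart_symm_unitChart (E := E) (tendsto_conj (E := E) h)] with w hw
  simp only [Function.comp_def, hw]
  congr 1
  group

/-- The velocity at the identity of a conjugated curve. -/
lemma hasDerivAt_conj {ζ : ℝ → G} {Y : E} (h0 : ζ 0 = 1) (hc : ContinuousAt ζ 0)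
    (hζ : HasDerivAt (fun t => unitChart E G (ζ t)) Y 0) (g : G) :
    HasDerivAt (fun t => unitChart E G (g * ζ t * g⁻¹)) (adjointMap E g Y) 0 := by
  have h1 := (show HasFDerivAt _ _ (unitChart E G (ζ 0)) by
    simpa [h0] using hasFDerivAt_adjointMap (E := E) g).comp_hasDerivAt 0 hζ
  refine h1.congr_of_eventuallyEq ?_
  have hc' : Filter.Tendsto ζ (𝓝 0) (𝓝 1) := h0 ▸ hc.tendsto
  filter_upwards [eventually_unitChart_symm_unitChart (E := E) hc'] with t ht
  simp only [Function.comp_def, ht]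

/-- The velocity at the identity of `u v⁻¹` vanishes if `u` and `v` have the same velocity. -/
lemma hasDerivAt_mul_inv {u v : ℝ → G} {Y : E} (hu0 : u 0 = 1) (hv0 : v 0 = 1)
    (huc : ContinuousAt u 0) (hvc : ContinuousAt v 0)
    (hu : HasDerivAt (fun t => unitChart E G (u t)) Y 0)
    (hv : HasDerivAt (fun t => unitChart E G (v t)) Y 0) :
    HasDerivAt (fun t => unitChart E G (u t * (v t)⁻¹)) 0 0 := by
  set z := unitChart E G 1 with hz
  let D : E × E → E := fun p => unitChart E G ((unitChart E G).symm p.1 *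
    ((unitChart E G).symm p.2)⁻¹)
  have hD : DifferentiableAt ℝ D (z, z) := by
    refine ContDiffAt.differentiableAt (n := ∞) ?_ (by simp)
    rw [← contMDiffAt_iff_contDiffAt]
    apply contMDiffAt_unitChart
    · apply ContMDiffAt.mul
      · exact ContMDiffAt.comp (g := (unitChart E G).symm) (f := Prod.fst)
          (z, z) contMDiffAt_unitChart_symm contDiff_fst.contMDiff.contMDiffAt
      · exact (ContMDiffAt.comp (g := (unitChart E G).symm) (f := Prod.snd)
          (z, z) contMDiffAt_unitChart_symm contDiff_snd.contMDiff.contMDiffAt).inv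
    · simp [hz]
  have hdiag : fderiv ℝ D (z, z) (Y, Y) = 0 := by
    have h1 : HasFDerivAt (fun x : E => (x, x))
        ((ContinuousLinearMap.id ℝ E).prod (ContinuousLinearMap.id ℝ E)) z :=
      (hasFDerivAt_id z).prodMk (hasFDerivAt_id z)
    have h2 := hD.hasFDerivAt.comp (f := fun x : E => (x, x)) z h1
    have h3 : (D ∘ fun x : E => (x, x)) = fun _ => z := by
      ext x; simp [D, hz]
    rw [h3] at h2
    have := h2.unique (hasFDerivAt_const z z)
    simpa using congrArg (fun L : E →L[ℝ] E => L Y) this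
  have h1 := (show HasFDerivAt D (fderiv ℝ D (z, z)) (unitChart E G (u 0), unitChart E G (v 0)) by
    rw [hu0, hv0]; exact hD.hasFDerivAt).comp_hasDerivAt
      (f := fun t => (unitChart E G (u t), unitChart E G (v t))) 0 (hu.prodMk hv)
  rw [hdiag] at h1
  refine h1.congr_of_eventuallyEq ?_
  have huc' : Filter.Tendsto u (𝓝 0) (𝓝 1) := hu0 ▸ huc.tendsto
  have hvc' : Filter.Tendsto v (𝓝 0) (𝓝 1) := hv0 ▸ hvc.tendsto
  filter_upwards [eventually_unitChart_symm_unitChart (E := E) huc',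
    eventually_unitChart_symm_unitChart (E := E) hvc'] with t ht ht'
  simp only [Function.comp_def, D, ht, ht']

/-- The relation `g y = (g y g⁻¹) g`, differentiated at `y = 1`. -/
lemma eventually_fderiv_chartMul {γ : ℝ → G} (hγ : Filter.Tendsto γ (𝓝 0) (𝓝 1)) (Y : E) :
    ∀ᶠ t in 𝓝 (0 : ℝ),
      fderiv ℝ (fun w => chartMul E G (unitChart E G (γ t), w)) (unitChart E G 1) Y
        = fderiv ℝ (fun w => chartMul E G (w, unitChart E G (γ t))) (unitChart E G 1)
          (adjointMap E (γ t) Y) := by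
  have hF := contDiffAt_chartMul (E := E) (G := G)
  have hd : ∀ᶠ p in 𝓝 (unitChart E G 1, unitChart E G 1),
      DifferentiableAt ℝ (chartMul E G) p := by
    filter_upwards [(hF.of_le (by norm_cast : (1 : ℕ∞ω) ≤ ∞)).eventually (by simp)] with p hp
    exact hp.differentiableAt (by simp)
  have hφ : Filter.Tendsto (fun t => unitChart E G (γ t)) (𝓝 0) (𝓝 (unitChart E G 1)) :=
    (continuousAt_extChartAt (I := 𝓘(ℝ, E)) (1 : G)).tendsto.comp hγ
  have hp : Filter.Tendsto (fun t => (unitChart E G 1, unitChart E G (γ t))) (𝓝 0)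
      (𝓝 (unitChart E G 1, unitChart E G 1)) := by
    rw [nhds_prod_eq]; exact tendsto_const_nhds.prodMk hφ
  filter_upwards [hp.eventually hd, eventually_unitChart_symm_unitChart (E := E) hγ] with t ht hγt
  have h1 : HasFDerivAt (fun w => chartMul E G (w, unitChart E G (γ t)))
      (fderiv ℝ (fun w => chartMul E G (w, unitChart E G (γ t))) (unitChart E G 1))
      (unitChart E G 1) := by
    refine DifferentiableAt.hasFDerivAt ?_
    exact DifferentiableAt.comp (g := chartMul E G) (unitChart E G 1) ht
      (hasFDerivAt_prodMk_left _ _).differentiableAt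
  have h2 := (show HasFDerivAt _ _ (unitChart E G (γ t * (unitChart E G).symm (unitChart E G 1) *
    (γ t)⁻¹)) by simpa using h1).comp (unitChart E G 1) (hasFDerivAt_adjointMap (γ t))
  have h3 : (fun w => chartMul E G (unitChart E G (γ t), w)) =ᶠ[𝓝 (unitChart E G 1)]
      ((fun w => chartMul E G (w, unitChart E G (γ t))) ∘
        fun w => unitChart E G (γ t * (unitChart E G).symm w * (γ t)⁻¹)) := by
    filter_upwards [eventually_unitChart_symm_unitChart (E := E) (tendsto_conj (E := E) (γ t))]
      with w hw
    simp only [Function.comp_def, chartMul, hw, hγt]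
    simp
  rw [h3.fderiv_eq, h2.fderiv]
  rfl

end UnitChart

/-! ### The Lie bracket in the chart at the identity -/

section Bracket

variable {E : Type*} [NormedAddCommGroup E] [NormedSpace ℝ E]
  {G : Type*} [TopologicalSpace G] [ChartedSpace E G] [Group G]

lemma hasMFDerivAt_iff_unitChart {γ : ℝ → G} (h0 : γ 0 = 1) {L : ℝ →L[ℝ] E} :
    HasMFDerivAt 𝓘(ℝ, ℝ) 𝓘(ℝ, E) γ 0 L ↔
      ContinuousAt γ 0 ∧ HasFDerivAt (fun t => unitChart E G (γ t)) L 0 := by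
  unfold HasMFDerivAt
  refine and_congr_right fun _ => ?_
  simp only [writtenInExtChartAt, h0, extChartAt_model_space_eq_id, PartialEquiv.refl_coe,
    PartialEquiv.refl_symm, Function.comp_id, id, modelWithCornersSelf_coe, Set.range_id]
  exact hasFDerivWithinAt_univ (E := ℝ) (F := E)

/-- The velocity at the identity of a curve, read in the chart. -/
lemma hasDerivAt_unitChart {γ : ℝ → G} (hγ : MDifferentiableAt 𝓘(ℝ, ℝ) 𝓘(ℝ, E) γ 0)
    (h0 : γ 0 = 1) :
    HasDerivAt (fun t => unitChart E G (γ t)) (mfderiv 𝓘(ℝ, ℝ) 𝓘(ℝ, E) γ 0 (1 : ℝ) : E) 0 := by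
  have h2 := ((hasMFDerivAt_iff_unitChart h0).1 hγ.hasMFDerivAt).2
  exact HasFDerivAt.hasDerivAt (F := E) h2

lemma hasMFDerivAt_of_unitChart {γ : ℝ → G} (hγ : ContinuousAt γ 0)
    (h0 : γ 0 = 1) (h : HasDerivAt (fun t => unitChart E G (γ t)) 0 0) :
    HasMFDerivAt 𝓘(ℝ, ℝ) 𝓘(ℝ, E) γ 0 (0 : ℝ →L[ℝ] E) := by
  refine (hasMFDerivAt_iff_unitChart h0).2 ⟨hγ, ?_⟩
  have := h.hasFDerivAt
  simpa using this

variable [LieGroup 𝓘(ℝ, E) ∞ G]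

/-- Near the identity, a left-invariant vector field read in the chart is a partial derivative of
the multiplication in the chart. -/
lemma mpullbackWithin_mulInvariantVectorField (X : GroupLieAlgebra 𝓘(ℝ, E) G) :
    (VectorField.mpullbackWithin 𝓘(ℝ, E) 𝓘(ℝ, E) (extChartAt 𝓘(ℝ, E) (1 : G)).symm
      (mulInvariantVectorField X) (Set.range 𝓘(ℝ, E)) : E → E) =ᶠ[𝓝 (unitChart E G 1)]
    fun u => fderiv ℝ (fun w => chartMul E G (u, w)) (unitChart E G 1) (X : E) := by
  filter_upwards [extChartAt_target_mem_nhds (I := 𝓘(ℝ, E)) (1 : G)] with u hu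
  have : IsManifold 𝓘(ℝ, E) 1 G := IsManifold.of_le (n := ∞) (by norm_cast)
  have hinv := ContinuousLinearMap.inverse_eq
    (mfderivWithin_extChartAt_symm_comp_mfderiv_extChartAt (I := 𝓘(ℝ, E)) hu)
    (mfderiv_extChartAt_comp_mfderivWithin_extChartAt_symm (I := 𝓘(ℝ, E)) hu)
  have hsrc := (extChartAt 𝓘(ℝ, E) (1 : G)).map_target hu
  set g := (extChartAt 𝓘(ℝ, E) (1 : G)).symm u with hg
  have h1 : HasMFDerivAt 𝓘(ℝ, E) 𝓘(ℝ, E) (extChartAt 𝓘(ℝ, E) (1 : G)) (g * 1)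
      (mfderiv 𝓘(ℝ, E) 𝓘(ℝ, E) (extChartAt 𝓘(ℝ, E) (1 : G)) g) := by
    rw [mul_one]
    exact (mdifferentiableAt_extChartAt (by simpa using hsrc)).hasMFDerivAt
  have h2 : HasMFDerivAt 𝓘(ℝ, E) 𝓘(ℝ, E) (g * ·) (1 : G)
      (mfderiv 𝓘(ℝ, E) 𝓘(ℝ, E) (g * ·) (1 : G)) :=
    ((contMDiff_mul_left (I := 𝓘(ℝ, E)) (n := ∞) (a := g)).contMDiffAt.mdifferentiableAt
      (by simp)).hasMFDerivAt
  have h3 := (h1.comp (1 : G) h2).2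
  simp only [writtenInExtChartAt, extChartAt_model_space_eq_id, PartialEquiv.refl_coe,
    Function.id_comp, modelWithCornersSelf_coe, Set.range_id] at h3
  let D : E →L[ℝ] E := (mfderiv 𝓘(ℝ, E) 𝓘(ℝ, E) (extChartAt 𝓘(ℝ, E) (1 : G)) g).comp
    (mfderiv 𝓘(ℝ, E) 𝓘(ℝ, E) (g * ·) (1 : G))
  have h4 : HasFDerivWithinAt (fun w => chartMul E G (u, w)) D Set.univ (unitChart E G 1) := h3
  rw [(hasFDerivWithinAt_univ.1 h4).fderiv, VectorField.mpullbackWithin_apply, hinv]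
  rfl

lemma lieBracket_chartMul_eq_zero [CompleteSpace E] (X Y : GroupLieAlgebra 𝓘(ℝ, E) G)
    (h : ⁅X, Y⁆ = 0) :
    VectorField.lieBracket ℝ
      (fun u => fderiv ℝ (fun w => chartMul E G (u, w)) (unitChart E G 1) (X : E))
      (fun u => fderiv ℝ (fun w => chartMul E G (u, w)) (unitChart E G 1) (Y : E))
      (unitChart E G 1) = 0 := by
  have : IsManifold 𝓘(ℝ, E) 1 G := IsManifold.of_le (n := ∞) (by norm_cast)
  have hs : (extChartAt 𝓘(ℝ, E) (1 : G)).symm ⁻¹' Set.univ ∩ Set.range 𝓘(ℝ, E) = Set.univ := by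
    simp
  rw [GroupLieAlgebra.bracket_def, ← VectorField.mlieBracketWithin_univ,
    VectorField.mlieBracketWithin_apply, hs] at h
  obtain ⟨e, he⟩ := isInvertible_mfderiv_extChartAt (I := 𝓘(ℝ, E))
    (mem_extChartAt_source (I := 𝓘(ℝ, E)) (1 : G))
  rw [← he, ContinuousLinearMap.inverse_equiv] at h
  have h0 := (map_eq_zero_iff e.symm e.symm.injective).1 h
  have h1 := mpullbackWithin_mulInvariantVectorField X
  have h2 := mpullbackWithin_mulInvariantVectorField Y
  have h3 := Filter.EventuallyEq.lieBracket_vectorField_eq (𝕜 := ℝ) h1 h2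
  refine h3.symm.trans ?_
  exact (congrFun VectorField.lieBracketWithin_univ _).symm.trans h0

end Bracket

/-! ### Curves whose Lie algebras commute -/

section AdjointOfCurves

variable {E : Type*} [NormedAddCommGroup E] [NormedSpace ℝ E]
  {G : Type*} [TopologicalSpace G] [ChartedSpace E G] [Group G]

lemma adjointMap_one : adjointMap E (1 : G) = ContinuousLinearMap.id ℝ E := by
  have h : (fun w => unitChart E G (1 * (unitChart E G).symm w * (1 : G)⁻¹))
      =ᶠ[𝓝 (unitChart E G 1)] id := by
    filter_upwards [eventually_unitChart_unitChart_symm (E := E) (G := G)] with w hw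
    simpa using hw
  rw [adjointMap, h.fderiv_eq, fderiv_id]

variable [LieGroup 𝓘(ℝ, E) ∞ G]

/-- The derivative of `Ad (γ t) Y` at a curve through the identity is the bracket of the velocity
of `γ` with `Y`; it is stated here for a vanishing bracket only. The vectors `X` and `Y` of the
Lie algebra are typed as vectors of the model space, in which the derivatives are taken. -/
lemma hasDerivAt_adjointMap [CompleteSpace E] {γ : ℝ → G} (hγ : ContMDiff 𝓘(ℝ, ℝ) 𝓘(ℝ, E) ∞ γ)
    (h0 : γ 0 = 1) (X Y : E)
    (hX : (mfderiv 𝓘(ℝ, ℝ) 𝓘(ℝ, E) γ 0 (1 : ℝ) : E) = X)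
    (hXY : @Bracket.bracket (GroupLieAlgebra 𝓘(ℝ, E) G) (GroupLieAlgebra 𝓘(ℝ, E) G) _ X Y = 0) :
    HasDerivAt (fun t => adjointMap E (γ t) Y) 0 0 := by
  have hcont : Filter.Tendsto γ (𝓝 0) (𝓝 1) := h0 ▸ hγ.continuous.tendsto 0
  have hγX : HasDerivAt (fun t => unitChart E G (γ t)) (X : E) 0 := by
    rw [← hX]; exact hasDerivAt_unitChart (hγ.contMDiffAt.mdifferentiableAt (by simp)) h0
  -- `Ad (γ t)` is a partial derivative of the smooth map `(t, w) ↦ γ t * w * (γ t)⁻¹`.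
  let Φ : ℝ × E → E := fun p =>
    unitChart E G (γ p.1 * (unitChart E G).symm p.2 * (γ p.1)⁻¹)
  have hΦ : ContDiffAt ℝ ∞ Φ (0, unitChart E G 1) := by
    rw [← contMDiffAt_iff_contDiffAt]
    have h1 : ContMDiffAt 𝓘(ℝ, ℝ × E) 𝓘(ℝ, E) ∞ (fun p : ℝ × E => γ p.1)
        (0, unitChart E G 1) := (hγ.comp contDiff_fst.contMDiff).contMDiffAt
    apply contMDiffAt_unitChart
    · refine (h1.mul ?_).mul h1.inv
      exact ContMDiffAt.comp (g := (unitChart E G).symm) (f := Prod.snd)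
        (0, unitChart E G 1) contMDiffAt_unitChart_symm contDiff_snd.contMDiff.contMDiffAt
    · simp [h0]
  have hdiff : DifferentiableAt ℝ (fun t => adjointMap E (γ t) Y) 0 := by
    have h1 : DifferentiableAt ℝ (fderiv ℝ Φ) (0, unitChart E G 1) :=
      (hΦ.fderiv_right (m := 1) (by norm_cast)).differentiableAt (by simp)
    have h2 : DifferentiableAt ℝ (fun t : ℝ => fderiv ℝ Φ (t, unitChart E G 1) (0, Y)) 0 :=
      (h1.comp (f := fun t : ℝ => (t, unitChart E G 1)) 0
        (hasFDerivAt_prodMk_left (0 : ℝ) (unitChart E G 1)).differentiableAt).clm_apply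
        (differentiableAt_const _)
    refine h2.congr_of_eventuallyEq ?_
    have h3 : Filter.Tendsto (fun t : ℝ => (t, unitChart E G 1)) (𝓝 0)
        (𝓝 (0, unitChart E G 1)) := Continuous.tendsto (by fun_prop) 0
    filter_upwards [h3.eventually (eventually_fderiv_prodMk_left hΦ)] with t ht
    exact ht Y
  have key := deriv_adjoint_eq_lieBracket (E := E)
    (contDiffAt_chartMul (E := E) (G := G)) chartMul_unit chartMul_unit' hγX (by rw [h0]) hdiff
    (by rw [h0, adjointMap_one]; rfl) (eventually_fderiv_chartMul hcont Y)
  rw [lieBracket_chartMul_eq_zero X Y hXY] at key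
  exact key ▸ hdiff.hasDerivAt

/-- If the Lie algebra of `P` commutes with `Y`, then a curve in `P` fixes `Y`. -/
lemma adjointMap_eq_self [CompleteSpace E] {P : Subgroup G} (Y : E)
    (hY : ∀ X ∈ QFT.lieAlgebraOf (E := E) P,
      @Bracket.bracket (GroupLieAlgebra 𝓘(ℝ, E) G) (GroupLieAlgebra 𝓘(ℝ, E) G) _ X Y = 0)
    {γ : ℝ → G} (hγ : ContMDiff 𝓘(ℝ, ℝ) 𝓘(ℝ, E) ∞ γ) (h0 : γ 0 = 1) (hP : ∀ t, γ t ∈ P)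
    (t : ℝ) : adjointMap E (γ t) Y = Y := by
  have hd : ∀ t, HasDerivAt (fun t => adjointMap E (γ t) Y) 0 t := by
    intro t₀
    let δ : ℝ → G := fun s => (γ t₀)⁻¹ * γ (t₀ + s)
    have hδ : ContMDiff 𝓘(ℝ, ℝ) 𝓘(ℝ, E) ∞ δ :=
      contMDiff_const.mul (hγ.comp (contDiff_const.add contDiff_id).contMDiff)
    have hδ0 : δ 0 = 1 := by simp [δ]
    have hδP : ∀ s, δ s ∈ P := fun s => P.mul_mem (P.inv_mem (hP _)) (hP _)
    have h1 := hasDerivAt_adjointMap hδ hδ0 _ Y rfl (hY _ ⟨δ, hδ, hδ0, hδP, rfl⟩)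
    have h2 : HasDerivAt (fun s => adjointMap E (δ (s - t₀)) Y) 0 t₀ := by
      refine HasDerivAt.comp_sub_const (f := fun s => adjointMap E (δ s) Y) t₀ t₀ ?_
      rw [sub_self]; exact h1
    have h3 := (adjointMap E (γ t₀)).hasFDerivAt.comp_hasDerivAt t₀ h2
    rw [map_zero] at h3
    refine h3.congr_of_eventuallyEq (Filter.Eventually.of_forall fun s => ?_)
    simp only [Function.comp_def]
    rw [← ContinuousLinearMap.comp_apply, ← adjointMap_mul]
    simp [δ]
  have := is_const_of_deriv_eq_zero (fun t => (hd t).differentiableAt) (fun t => (hd t).deriv) t 0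
  simp only [h0, adjointMap_one] at this
  exact this

/-- A curve in a Lie group whose derivative vanishes is constant. -/
lemma eq_of_hasMFDerivAt_zero [CompleteSpace E] [T2Space G] {ψ : ℝ → G}
    (hψ : ∀ t, HasMFDerivAt 𝓘(ℝ, ℝ) 𝓘(ℝ, E) ψ t (0 : ℝ →L[ℝ] E)) (s t : ℝ) : ψ s = ψ t := by
  have : IsManifold 𝓘(ℝ, E) 1 G := IsManifold.of_le (n := ∞) (by norm_cast)
  let v : (x : G) → TangentSpace 𝓘(ℝ, E) x := fun x => (0 : E)
  have hv : ContMDiff 𝓘(ℝ, E) 𝓘(ℝ, E).tangent 1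
    (fun x => (⟨x, v x⟩ : TangentBundle 𝓘(ℝ, E) G)) :=
    Bundle.contMDiff_zeroSection ℝ (TangentSpace 𝓘(ℝ, E) : G → Type _)
  have hz : (1 : ℝ →L[ℝ] ℝ).smulRight (0 : E) = 0 := by ext; simp
  have h1 : IsMIntegralCurve ψ v := fun t => by
    have : ∀ L : ℝ →L[ℝ] E, L = 0 → HasMFDerivAt 𝓘(ℝ, ℝ) 𝓘(ℝ, E) ψ t L := by
      rintro _ rfl; exact hψ t
    exact this _ hz
  have h2 : IsMIntegralCurve (fun _ => ψ t) v := fun s => by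
    have : ∀ L : ℝ →L[ℝ] E, L = 0 → HasMFDerivAt 𝓘(ℝ, ℝ) 𝓘(ℝ, E) (fun _ => ψ t) s L := by
      rintro _ rfl; exact hasMFDerivAt_const (ψ t) s
    exact this _ hz
  exact congrFun (isMIntegralCurve_Ioo_eq_of_contMDiff_boundaryless (t₀ := t) hv h1 h2 rfl) s

/-- An element that fixes the Lie algebra of `K` under the adjoint action commutes with every
curve in `K` through the identity. -/
lemma commute_of_adjointMap_eq_self [CompleteSpace E] [T2Space G] {K : Subgroup G} {g : G}
    (hg : ∀ Y ∈ QFT.lieAlgebraOf (E := E) K, adjointMap E g (Y : E) = Y)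
    {η : ℝ → G} (hη : ContMDiff 𝓘(ℝ, ℝ) 𝓘(ℝ, E) ∞ η) (h0 : η 0 = 1) (hK : ∀ t, η t ∈ K)
    (t : ℝ) : g * η t = η t * g := by
  have key : ∀ t, HasMFDerivAt 𝓘(ℝ, ℝ) 𝓘(ℝ, E) (fun t => g * η t * g⁻¹ * (η t)⁻¹) t
      (0 : ℝ →L[ℝ] E) := by
    intro t₀
    let ζ : ℝ → G := fun s => (η t₀)⁻¹ * η (t₀ + s)
    have hζ : ContMDiff 𝓘(ℝ, ℝ) 𝓘(ℝ, E) ∞ ζ :=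
      contMDiff_const.mul (hη.comp (contDiff_const.add contDiff_id).contMDiff)
    have hζ0 : ζ 0 = 1 := by simp [ζ]
    have hζK : ∀ s, ζ s ∈ K := fun s => K.mul_mem (K.inv_mem (hK _)) (hK _)
    -- `g ζ(s) g⁻¹` and `ζ(s)` have the same velocity, so `g ζ(s) g⁻¹ ζ(s)⁻¹` has velocity zero.
    have hvel := hasDerivAt_unitChart (hζ.contMDiffAt.mdifferentiableAt (by simp)) hζ0
    have hconj := hasDerivAt_conj hζ0 hζ.continuous.continuousAt hvel g
    rw [hg _ ⟨ζ, hζ, hζ0, hζK, rfl⟩] at hconj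
    have hgζ : ContMDiff 𝓘(ℝ, ℝ) 𝓘(ℝ, E) ∞ (fun s => g * ζ s * g⁻¹) :=
      (contMDiff_const.mul hζ).mul contMDiff_const
    let δ : ℝ → G := fun s => g * ζ s * g⁻¹ * (ζ s)⁻¹
    have hδ := hasMFDerivAt_of_unitChart (E := E) (γ := δ)
      (hgζ.mul hζ.inv).continuous.continuousAt (by simp [δ, hζ0])
      (hasDerivAt_mul_inv (by simp [hζ0]) hζ0 hgζ.continuous.continuousAt
        hζ.continuous.continuousAt hconj hvel)
    have hψ : (fun t => g * η t * g⁻¹ * (η t)⁻¹) =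
        (fun x => g * η t₀ * g⁻¹ * x * (η t₀)⁻¹) ∘ (δ ∘ fun t => t - t₀) := by
      ext t; simp only [Function.comp_def, δ, ζ]; rw [add_sub_cancel]; group
    have hM : ContMDiff 𝓘(ℝ, E) 𝓘(ℝ, E) ∞ (fun x => g * η t₀ * g⁻¹ * x * (η t₀)⁻¹) :=
      (contMDiff_const.mul contMDiff_id).mul contMDiff_const
    have hs : HasMFDerivAt 𝓘(ℝ, ℝ) 𝓘(ℝ, ℝ) (fun t => t - t₀) t₀ (ContinuousLinearMap.id ℝ ℝ) :=
      ((hasFDerivAt_id t₀).sub_const t₀).hasMFDerivAt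
    have hδ' : HasMFDerivAt 𝓘(ℝ, ℝ) 𝓘(ℝ, E) δ (t₀ - t₀) (0 : ℝ →L[ℝ] E) := by
      rw [sub_self]; exact hδ
    have h1 := (hM.contMDiffAt.mdifferentiableAt (by simp)).hasMFDerivAt.comp t₀
      (HasMFDerivAt.comp (f := fun t => t - t₀) t₀ hδ' hs)
    rw [hψ]
    have h2 : ∀ L : ℝ →L[ℝ] E, L = 0 → HasMFDerivAt 𝓘(ℝ, ℝ) 𝓘(ℝ, E)
        ((fun x => g * η t₀ * g⁻¹ * x * (η t₀)⁻¹) ∘ (δ ∘ fun t => t - t₀)) t₀ L →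
        HasMFDerivAt 𝓘(ℝ, ℝ) 𝓘(ℝ, E)
          ((fun x => g * η t₀ * g⁻¹ * x * (η t₀)⁻¹) ∘ (δ ∘ fun t => t - t₀)) t₀
          (0 : ℝ →L[ℝ] E) := by
      rintro _ rfl h; exact h
    have h3 : ∀ A : E →L[ℝ] E,
        A.comp ((0 : ℝ →L[ℝ] E).comp (ContinuousLinearMap.id ℝ ℝ)) = 0 := by
      intro A; ext; simp
    exact h2 _ (h3 _) h1
  have := eq_of_hasMFDerivAt_zero key t 0
  simp only [h0, mul_one, inv_one, mul_inv_cancel] at this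
  rwa [mul_inv_eq_one, mul_inv_eq_iff_eq_mul] at this

end AdjointOfCurves

/-! ### Contraction in compact normal subgroups -/

/-- In a compact group, an element that is contracted to the identity by the powers of another
element is trivial: at a cluster point of the powers, it is conjugate to the identity. -/
lemma eq_one_of_tendsto_conj_pow {G : Type*} [TopologicalSpace G] [T2Space G] [Group G]
    [IsTopologicalGroup G] {K : Subgroup G} (hK : IsCompact (K : Set G)) {k y : G} (hk : k ∈ K)
    (h : Filter.Tendsto (fun n : ℕ => k ^ n * y * (k ^ n)⁻¹) Filter.atTop (𝓝 1)) : y = 1 := by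
  let F : Ultrafilter ℕ := Filter.hyperfilter ℕ
  have hF : (F : Filter ℕ) ≤ Filter.atTop := by
    rw [← Nat.cofinite_eq_atTop]; exact Filter.hyperfilter_le_cofinite
  obtain ⟨k₀, -, hk₀⟩ := hK.ultrafilter_le_nhds' (F.map fun n => k ^ n)
    (Ultrafilter.mem_map.2 (Filter.univ_mem' fun n => K.pow_mem hk n))
  have h1 : Filter.Tendsto (fun n : ℕ => k ^ n) F (𝓝 k₀) := hk₀
  have h2 := (h1.mul (tendsto_const_nhds (x := y))).mul h1.inv
  have h3 := tendsto_nhds_unique h2 (h.mono_left hF)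
  have h4 : k₀ * y = k₀ := mul_inv_eq_one.1 h3
  exact mul_eq_left.1 h4

section Commutator

variable {Γ G : Type*} [Group Γ] [Group G]

/-- If the defects `h j(γ) h⁻¹ j(γ)⁻¹` of generators commute with the range of `j`, then the
defect is a homomorphism with values in the centralizer of the range of `j`. -/
lemma exists_commutatorHom (j : Γ →* G) (h : G) {C : Set Γ} (hC : Subgroup.closure C = ⊤)
    (hcomm : ∀ x ∈ C, ∀ γ, Commute (j γ) (h * j x * h⁻¹ * (j x)⁻¹)) :
    ∃ φ : Γ →* G, ∀ γ, φ γ = h * j γ * h⁻¹ * (j γ)⁻¹ := by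
  have key : ∀ x y : Γ, Commute (j x) (h * j y * h⁻¹ * (j y)⁻¹) →
      h * j (x * y) * h⁻¹ * (j (x * y))⁻¹ =
        (h * j x * h⁻¹ * (j x)⁻¹) * (h * j y * h⁻¹ * (j y)⁻¹) := by
    intro x y hxy
    calc _ = h * j x * h⁻¹ * (h * j y * h⁻¹ * (j y)⁻¹ * (j x)⁻¹) := by rw [map_mul]; group
      _ = h * j x * h⁻¹ * ((j x)⁻¹ * (h * j y * h⁻¹ * (j y)⁻¹)) := by rw [hxy.inv_left.eq]
      _ = _ := by group
  have hall : ∀ y γ, Commute (j γ) (h * j y * h⁻¹ * (j y)⁻¹) := by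
    intro y
    have hy : y ∈ Subgroup.closure C := hC ▸ Subgroup.mem_top y
    induction hy using Subgroup.closure_induction with
    | mem x hx => exact hcomm x hx
    | one => intro γ; simp
    | mul x y _ _ hx hy =>
      intro γ
      rw [key x y (hy x)]
      exact (hx γ).mul_right (hy γ)
    | inv x _ hx =>
      intro γ
      have : h * j x⁻¹ * h⁻¹ * (j x⁻¹)⁻¹ = (h * j x * h⁻¹ * (j x)⁻¹)⁻¹ := by
        have h1 := key x⁻¹ x (hx _)
        rw [inv_mul_cancel] at h1
        simp only [map_one, mul_one, mul_inv_cancel, inv_one] at h1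
        exact eq_inv_of_mul_eq_one_left h1.symm
      rw [this]
      exact (hx γ).inv_right
  exact ⟨MonoidHom.mk' (fun γ => h * j γ * h⁻¹ * (j γ)⁻¹) fun x y => key x y (hall y x),
    fun _ => rfl⟩

end Commutator

/-- Let `K` be a compact normal subgroup of a Lie group whose Lie algebra commutes with that of the
image of `j`. If the source of `j` is generated by curves each of which is contracted by a
conjugation, then the image of `j` commutes with `K`. -/
theorem commute_of_contracted_curves {E : Type*} [NormedAddCommGroup E] [NormedSpace ℝ E]
    [CompleteSpace E] {G : Type*} [TopologicalSpace G] [T2Space G] [ChartedSpace E G] [Group G]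
    [LieGroup 𝓘(ℝ, E) ∞ G] {Γ : Type*} [Group Γ] (j : Γ →* G) {K : Subgroup G}
    (hK : IsCompact (K : Set G)) (hKn : K.Normal)
    (hbr : ∀ X ∈ QFT.lieAlgebraOf (E := E) j.range, ∀ Y ∈ QFT.lieAlgebraOf (E := E) K, ⁅X, Y⁆ = 0)
    (C : Set (ℝ → Γ)) (hgen : Subgroup.closure {γ | ∃ x ∈ C, ∃ t, x t = γ} = ⊤)
    (hone : ∀ x ∈ C, x 0 = 1)
    (hsmooth : ∀ x ∈ C, ContMDiff 𝓘(ℝ, ℝ) 𝓘(ℝ, E) ∞ fun t => j (x t))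
    (hcontr : ∀ x ∈ C, ∃ a : Γ, ∃ r : ℝ, |r| < 1 ∧ ∀ t, a * x t * a⁻¹ = x (r * t))
    {h : G} (hh : h ∈ K) (γ : Γ) : h * j γ = j γ * h := by
  have : IsTopologicalGroup G := topologicalGroup_of_lieGroup 𝓘(ℝ, E) ∞
  have hdef : ∀ γ, h * j γ * h⁻¹ * (j γ)⁻¹ ∈ K := by
    intro γ
    have := K.mul_mem hh (hKn.conj_mem _ (K.inv_mem hh) (j γ))
    simpa [mul_assoc] using this
  have hds : ∀ x ∈ C, ContMDiff 𝓘(ℝ, ℝ) 𝓘(ℝ, E) ∞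
      fun t => h * j (x t) * h⁻¹ * (j (x t))⁻¹ := fun x hx =>
    ((contMDiff_const.mul (hsmooth x hx)).mul contMDiff_const).mul (hsmooth x hx).inv
  -- The defects of the generating curves are curves in `K`, so they commute with the image of `j`.
  have hcomm : ∀ y ∈ {γ | ∃ x ∈ C, ∃ t, x t = γ}, ∀ γ,
      Commute (j γ) (h * j y * h⁻¹ * (j y)⁻¹) := by
    rintro _ ⟨x, hx, t, rfl⟩ γ
    have hγ : γ ∈ Subgroup.closure {γ | ∃ x ∈ C, ∃ t, x t = γ} := hgen ▸ Subgroup.mem_top γ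
    induction hγ using Subgroup.closure_induction with
    | mem _ hy =>
      obtain ⟨y, hy, s, rfl⟩ := hy
      refine commute_of_adjointMap_eq_self (E := E) (K := K) (fun Y hY => ?_) (hds x hx)
        (by simp [hone x hx]) (fun t => hdef (x t)) t
      exact adjointMap_eq_self (E := E) (P := j.range) Y (fun X hX => hbr X hX Y hY) (hsmooth y hy)
        (by simp [hone y hy]) (fun t => ⟨y t, rfl⟩) s
    | one => simp
    | mul a b _ _ ha hb => rw [map_mul]; exact ha.mul_left hb
    | inv a _ ha => rw [map_inv]; exact ha.inv_left
  obtain ⟨φ, hφ⟩ := exists_commutatorHom j h hgen hcomm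
  have hker : φ.ker = ⊤ := by
    rw [eq_top_iff, ← hgen, Subgroup.closure_le]
    rintro _ ⟨x, hx, t, rfl⟩
    obtain ⟨a, r, hr, hax⟩ := hcontr x hx
    refine eq_one_of_tendsto_conj_pow hK (k := φ a) (by rw [hφ]; exact hdef a) ?_
    have hiter : ∀ n : ℕ, a ^ n * x t * (a ^ n)⁻¹ = x (r ^ n * t) := by
      intro n
      induction n with
      | zero => simp
      | succ n ih =>
        rw [pow_succ', pow_succ', mul_assoc r, ← hax, ← ih]
        group
    have hcont : Filter.Tendsto (fun s => φ (x s)) (𝓝 0) (𝓝 1) := by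
      simp only [hφ]
      simpa [hone x hx] using (hds x hx).continuous.tendsto 0
    have hr' : Filter.Tendsto (fun n : ℕ => r ^ n * t) Filter.atTop (𝓝 0) := by
      simpa using (tendsto_pow_atTop_nhds_zero_of_abs_lt_one hr).mul_const t
    refine (hcont.comp hr').congr fun n => ?_
    simp only [Function.comp_def, ← hiter, map_mul, map_pow, map_inv]
  have hγ : φ γ = 1 := by
    rw [← MonoidHom.mem_ker, hker]; exact Subgroup.mem_top γ
  rw [hφ] at hγ
  exact mul_inv_eq_iff_eq_mul.1 (mul_inv_eq_one.1 hγ)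

/-! ### Null rotations in the Clifford algebra -/

section NullRotations

open CliffordAlgebra QuadraticMap

variable {V : Type*} [AddCommGroup V] [Module ℝ V] (Q : QuadraticForm ℝ V)

/-- The monoid generated by the null rotations `1 + n u`, with `n` null and `u` anisotropic and
orthogonal to `n`. It is a group, since `1 - n u` is inverse to `1 + n u`. That `u` is anisotropic
makes `1 + n u = (n + u / Q u) u` a product of two vectors, and so an element of the spin group. -/
def nullRotations : Submonoid (CliffordAlgebra Q) :=
  Submonoid.closure {x | ∃ n u, Q n = 0 ∧ polar Q n u = 0 ∧ Q u ≠ 0 ∧ 1 + ι Q n * ι Q u = x}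

variable {Q}

lemma algebraMap_clifford_injective : Function.Injective (algebraMap ℝ (CliffordAlgebra Q)) :=
  (algebraMap ℝ (CliffordAlgebra Q)).injective

lemma ι_mul_self (v : V) : ι Q v * ι Q v = Q v • 1 := by
  rw [ι_sq_scalar, Algebra.algebraMap_eq_smul_one]

lemma ι_mul_ι_swap (v w : V) : ι Q v * ι Q w = polar Q v w • 1 - ι Q w * ι Q v := by
  rw [eq_sub_iff_add_eq, ι_mul_ι_add_swap, Algebra.algebraMap_eq_smul_one]

lemma ι_mul_ι_anticomm {v w : V} (h : polar Q v w = 0) :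
    ι Q v * ι Q w = -(ι Q w * ι Q v) := by
  rw [ι_mul_ι_swap, h, zero_smul, zero_sub]

lemma polar_self_real (v : V) : polar Q v v = 2 * Q v := by
  rw [polar_self, two_smul, two_mul]

lemma map_sub_real (v w : V) : Q (v - w) = Q v + Q w - polar Q v w := by
  have := QuadraticMap.map_add Q v (-w)
  rw [← sub_eq_add_neg, QuadraticMap.map_neg, polar_neg_right] at this
  rw [this]; ring

lemma one_add_mul_one_add (n u u' : V) (hn : Q n = 0) (hnu : polar Q n u = 0) :
    (1 + ι Q n * ι Q u) * (1 + ι Q n * ι Q u') = 1 + ι Q n * ι Q (u + u') := by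
  have h1 := ι_mul_ι_anticomm hnu
  have h2 : ι Q n * ι Q u * (ι Q n * ι Q u') = 0 := by
    calc ι Q n * ι Q u * (ι Q n * ι Q u') = -(ι Q u * (ι Q n * ι Q n) * ι Q u') := by
          rw [h1]; noncomm_ring
      _ = 0 := by rw [ι_mul_self, hn]; simp
  have h3 : ∀ a b c : CliffordAlgebra Q, a * b * (a * c) = 0 →
      (1 + a * b) * (1 + a * c) = 1 + a * (b + c) := by
    intro a b c h
    calc _ = 1 + a * (b + c) + a * b * (a * c) := by noncomm_ring
      _ = _ := by rw [h, add_zero]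
  rw [map_add, h3 _ _ _ h2]

/-- The vector `u` may be isotropic: it is then split as `t y + (u - t y)` with both summands
anisotropic. -/
lemma one_add_mem_nullRotations {n u y : V} (hn : Q n = 0) (hnu : polar Q n u = 0)
    (hny : polar Q n y = 0) (hy : Q y ≠ 0) : 1 + ι Q n * ι Q u ∈ nullRotations Q := by
  obtain ⟨t, ht, ht'⟩ : ∃ t : ℝ, t ≠ 0 ∧ Q (u - t • y) ≠ 0 := by
    by_contra! hcon
    have h1 := hcon 1 (by norm_num)
    have h2 := hcon (-1) (by norm_num)
    have h3 := hcon 2 (by norm_num)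
    simp only [map_sub_real, QuadraticMap.map_smul, polar_smul_right, smul_eq_mul] at h1 h2 h3
    apply hy; linarith
  have h := one_add_mul_one_add (Q := Q) n (t • y) (u - t • y) hn (by simp [polar_smul_right, hny])
  rw [add_sub_cancel] at h
  rw [← h]
  refine mul_mem (Submonoid.subset_closure ⟨n, t • y, hn, by simp [polar_smul_right, hny], ?_, rfl⟩)
    (Submonoid.subset_closure ⟨n, u - t • y, hn, by simp [polar_smul_right, hny, hnu], ht', rfl⟩)
  rw [QuadraticMap.map_smul, smul_eq_mul]; positivity

lemma reverse_mem_nullRotations {x : CliffordAlgebra Q} (hx : x ∈ nullRotations Q) :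
    reverse x ∈ nullRotations Q := by
  induction hx using Submonoid.closure_induction with
  | mem x hx =>
    obtain ⟨n, u, hn, hnu, hu, rfl⟩ := hx
    refine Submonoid.subset_closure ⟨n, -u, hn, by simp [hnu], by simpa using hu, ?_⟩
    simp only [map_add, reverse.map_one, reverse.map_mul, reverse_ι, map_neg]
    rw [ι_mul_ι_anticomm (v := u) (w := n) (by rwa [polar_comm])]
    simp
  | one => simp
  | mul x y _ _ hx hy => rw [reverse.map_mul]; exact mul_mem hy hx

lemma involute_nullRotations {x : CliffordAlgebra Q} (hx : x ∈ nullRotations Q) :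
    involute x = x := by
  induction hx using Submonoid.closure_induction with
  | mem x hx => obtain ⟨n, u, hn, hnu, hu, rfl⟩ := hx; simp
  | one => simp
  | mul x y _ _ hx hy => rw [map_mul, hx, hy]

lemma reverse_mul_self_nullRotations {x : CliffordAlgebra Q} (hx : x ∈ nullRotations Q) :
    reverse x * x = 1 := by
  induction hx using Submonoid.closure_induction with
  | mem x hx =>
    obtain ⟨n, u, hn, hnu, hu, rfl⟩ := hx
    have h := one_add_mul_one_add (Q := Q) n (-u) u hn (by simp [hnu])
    simp only [map_add, reverse.map_one, reverse.map_mul, reverse_ι, map_neg] at h ⊢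
    rw [ι_mul_ι_anticomm (v := u) (w := n) (by rwa [polar_comm]), ← mul_neg, h]
    simp
  | one => simp
  | mul x y _ _ hx hy =>
    rw [reverse.map_mul, mul_assoc, ← mul_assoc _ x, hx, one_mul, hy]

/-- The vector `v n v / Q v`, the negative of the reflection of `n` in `v⊥`. -/
lemma exists_ι_eq_conj (v n : V) :
    ∃ n', ι Q n' = (Q v)⁻¹ • (ι Q v * ι Q n * ι Q v) :=
  ⟨(Q v)⁻¹ • (polar Q v n • v - Q v • n), by rw [map_smul, ι_mul_ι_mul_ι]⟩

/-- Null rotations are normalized by every anisotropic vector. -/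
lemma conj_mem_nullRotations {v : V} (hv : Q v ≠ 0) {x : CliffordAlgebra Q}
    (hx : x ∈ nullRotations Q) : (Q v)⁻¹ • (ι Q v * x * ι Q v) ∈ nullRotations Q := by
  have hvv := ι_mul_self (Q := Q) v
  have hmid : ∀ a b : CliffordAlgebra Q, ((Q v)⁻¹ • (ι Q v * a * ι Q v)) *
      ((Q v)⁻¹ • (ι Q v * b * ι Q v)) = (Q v)⁻¹ • (ι Q v * (a * b) * ι Q v) := by
    intro a b
    have : ι Q v * a * ι Q v * (ι Q v * b * ι Q v) = Q v • (ι Q v * (a * b) * ι Q v) := by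
      calc _ = ι Q v * a * (ι Q v * ι Q v) * b * ι Q v := by noncomm_ring
        _ = _ := by rw [hvv]; simp [mul_assoc]
    rw [smul_mul_smul_comm, this, smul_smul]
    congr 1; field_simp
  have hone : (Q v)⁻¹ • (ι Q v * 1 * ι Q v) = 1 := by
    rw [mul_one, hvv, smul_smul, inv_mul_cancel₀ hv, one_smul]
  have hQ : ∀ a a', ι Q a' = (Q v)⁻¹ • (ι Q v * ι Q a * ι Q v) → Q a' = Q a := by
    intro a a' h
    apply algebraMap_clifford_injective (Q := Q)
    rw [← ι_sq_scalar, h, hmid, ι_mul_self, Algebra.algebraMap_eq_smul_one, mul_smul_comm,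
      smul_mul_assoc, smul_comm, hone]
  induction hx using Submonoid.closure_induction with
  | mem x hx =>
    obtain ⟨n, u, hn, hnu, hu, rfl⟩ := hx
    obtain ⟨n', hn'⟩ := exists_ι_eq_conj (Q := Q) v n
    obtain ⟨u', hu'⟩ := exists_ι_eq_conj (Q := Q) v u
    refine Submonoid.subset_closure ⟨n', u', (hQ _ _ hn').trans hn, ?_, ?_, ?_⟩
    · have hsum : Q (n' + u') = Q (n + u) := hQ _ _ (by
        rw [map_add, map_add, hn', hu', ← smul_add]; congr 1; noncomm_ring)
      rw [polar, hsum, hQ _ _ hn', hQ _ _ hu']; exact hnu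
    · rwa [hQ _ _ hu']
    · rw [hn', hu', hmid, mul_add, add_mul, smul_add, hone]
  | one => rw [hone]; exact one_mem _
  | mul x y _ _ hx hy => rw [← hmid]; exact mul_mem hx hy

variable (Q) in
/-- Two vectors of the same nonzero length are equivalent if their quotient `v⁻¹ w` in the Clifford
algebra is a product of null rotations. -/
def NullEquiv (v w : V) : Prop := Q v = Q w ∧ (Q v)⁻¹ • (ι Q v * ι Q w) ∈ nullRotations Q

namespace NullEquiv

variable {v w x : V}

lemma refl (hv : Q v ≠ 0) : NullEquiv Q v v :=
  ⟨rfl, by rw [ι_mul_self, smul_smul, inv_mul_cancel₀ hv, one_smul]; exact one_mem _⟩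

lemma symm (h : NullEquiv Q v w) : NullEquiv Q w v := by
  refine ⟨h.1.symm, ?_⟩
  have := reverse_mem_nullRotations h.2
  rwa [map_smul, reverse.map_mul, reverse_ι, reverse_ι, h.1] at this

lemma trans (hv : Q v ≠ 0) (h : NullEquiv Q v w) (h' : NullEquiv Q w x) :
    NullEquiv Q v x := by
  refine ⟨h.1.trans h'.1, ?_⟩
  have := mul_mem h.2 h'.2
  rw [smul_mul_smul_comm, mul_assoc, ← mul_assoc (ι Q w), ι_mul_self, ← h.1, smul_mul_assoc,
    one_mul, mul_smul_comm, smul_smul, inv_mul_cancel_right₀ hv] at this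
  exact this

lemma neg (h : NullEquiv Q v w) : NullEquiv Q (-v) (-w) := by
  refine ⟨by simpa using h.1, ?_⟩
  simpa using h.2

/-- The Eichler transformation `v ↦ (1 + n u) v (1 - n u)` does not change the equivalence class of
an anisotropic vector, because null rotations are normalized by `v`. -/
lemma eichler (hv : Q v ≠ 0) {n u : V} (hn : Q n = 0) (hnu : polar Q n u = 0)
    (hmem : ∀ u', polar Q n u' = 0 → 1 + ι Q n * ι Q u' ∈ nullRotations Q) :
    NullEquiv Q v (v - polar Q v n • u + polar Q v u • n - (Q u * polar Q v n) • n) := by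
  set w := v - polar Q v n • u + polar Q v u • n - (Q u * polar Q v n) • n with hw
  have hι : (1 + ι Q n * ι Q u) * ι Q v * (1 + ι Q n * ι Q (-u)) = ι Q w := by
    have hnn := ι_mul_self (Q := Q) n
    have huu := ι_mul_self (Q := Q) u
    have hun : ι Q u * ι Q n = -(ι Q n * ι Q u) := ι_mul_ι_anticomm (by rwa [polar_comm])
    have huv := ι_mul_ι_swap (Q := Q) u v
    have hnv := ι_mul_ι_swap (Q := Q) n v
    rw [hn, zero_smul] at hnn
    have h1 : ι Q n * ι Q u * ι Q v = polar Q v u • ι Q n - polar Q v n • ι Q u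
        + ι Q v * ι Q n * ι Q u := by
      rw [mul_assoc, huv, mul_sub, ← mul_assoc, hnv, polar_comm Q u, polar_comm Q n]
      simp only [mul_smul_comm, mul_one, sub_mul, smul_mul_assoc, one_mul]
      abel
    have h2 : ι Q n * ι Q u * ι Q v * (ι Q n * ι Q u) = (Q u * polar Q v n) • ι Q n := by
      have e1 : ι Q n * (ι Q n * ι Q u) = 0 := by rw [← mul_assoc, hnn, zero_mul]
      have e2 : ι Q u * (ι Q n * ι Q u) = -(Q u • ι Q n) := by
        rw [← mul_assoc, hun, neg_mul, mul_assoc, huu, mul_smul_comm, mul_one]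
      have e3 : ι Q v * ι Q n * ι Q u * (ι Q n * ι Q u) = 0 := by
        rw [mul_assoc, e2, mul_neg, mul_smul_comm, mul_assoc, hnn]; simp
      rw [h1, add_mul, sub_mul, smul_mul_assoc, smul_mul_assoc, e1, e2, e3, smul_neg, smul_smul,
        mul_comm (Q u)]
      simp
    have h3 : (1 + ι Q n * ι Q u) * ι Q v * (1 + ι Q n * ι Q (-u)) =
        ι Q v + ι Q n * ι Q u * ι Q v - ι Q v * ι Q n * ι Q u
          - ι Q n * ι Q u * ι Q v * (ι Q n * ι Q u) := by
      rw [map_neg]; noncomm_ring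
    rw [h3, h2, h1, hw]
    simp only [map_sub, map_add, map_smul]
    abel
  have hE := hmem u hnu
  have hE' := hmem (-u) (by simp [hnu])
  refine ⟨?_, ?_⟩
  · apply algebraMap_clifford_injective (Q := Q)
    have hinv : (1 + ι Q n * ι Q (-u)) * (1 + ι Q n * ι Q u) = 1 := by
      rw [one_add_mul_one_add n (-u) u hn (by simp [hnu])]; simp
    have hinv' : (1 + ι Q n * ι Q u) * (1 + ι Q n * ι Q (-u)) = 1 := by
      rw [one_add_mul_one_add n u (-u) hn hnu]; simp
    set A := 1 + ι Q n * ι Q u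
    set B := 1 + ι Q n * ι Q (-u)
    rw [← ι_sq_scalar Q w, ← hι]
    calc algebraMap ℝ (CliffordAlgebra Q) (Q v)
        = A * B * algebraMap ℝ (CliffordAlgebra Q) (Q v) := by
          rw [hinv', one_mul]
      _ = A * (algebraMap ℝ (CliffordAlgebra Q) (Q v)) * B := by
          rw [mul_assoc, mul_assoc, Algebra.commutes]
      _ = A * ι Q v * (B * A) * ι Q v * B := by rw [hinv, ← ι_sq_scalar]; simp [mul_assoc]
      _ = _ := by simp [mul_assoc]
  · rw [← hι]
    have := mul_mem (conj_mem_nullRotations hv hE) hE'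
    rw [smul_mul_assoc] at this
    simpa [mul_assoc] using this

end NullEquiv

end NullRotations

/-! ### Generation of the spin group by null rotations -/

section Generation

open CliffordAlgebra QuadraticMap

variable {V : Type*} [AddCommGroup V] [Module ℝ V] {Q : QuadraticForm ℝ V}

variable (Q) in
/-- A hyperbolic pair `e, f` of null vectors, and an anisotropic vector `y` orthogonal to it. -/
structure IsHyperbolicTriple (e f y : V) : Prop where
  left : Q e = 0
  right : Q f = 0
  pair : polar Q e f = 1
  left_orth : polar Q e y = 0
  right_orth : polar Q f y = 0
  aniso : Q y ≠ 0

namespace IsHyperbolicTriple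

variable {e f y v w : V}

lemma swap (H : IsHyperbolicTriple Q e f y) : IsHyperbolicTriple Q f e y :=
  ⟨H.right, H.left, by rw [polar_comm, H.pair], H.right_orth, H.left_orth, H.aniso⟩

lemma map_plane (H : IsHyperbolicTriple Q e f y) (a b : ℝ) : Q (a • e + b • f) = a * b := by
  rw [QuadraticMap.map_add Q, QuadraticMap.map_smul, QuadraticMap.map_smul, H.left, H.right,
    polar_smul_left, polar_smul_right, H.pair]
  simp

lemma one_add_mem (H : IsHyperbolicTriple Q e f y) {u : V} (hu : polar Q e u = 0) :
    1 + ι Q e * ι Q u ∈ nullRotations Q :=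
  one_add_mem_nullRotations H.left hu H.left_orth H.aniso

/-- An anisotropic vector not orthogonal to `e` is equivalent to a vector of the hyperbolic
plane. -/
lemma nullEquiv_plane (H : IsHyperbolicTriple Q e f y) (hv : Q v ≠ 0) (hβ : polar Q v e ≠ 0) :
    NullEquiv Q v ((Q v / polar Q v e) • e + polar Q v e • f) := by
  set β := polar Q v e with hβdef
  have hee : polar Q e e = 0 := by rw [polar_self_real, H.left, mul_zero]
  -- The Eichler transformation along `e` that removes the component of `v` orthogonal to `e, f`.
  let u : V := β⁻¹ • (v - polar Q v f • e - β • f)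
  have hu : polar Q e u = 0 := by
    simp only [u, polar_smul_right, polar_sub_right, smul_eq_mul, hee, H.pair]
    rw [polar_comm Q e v, ← hβdef]; ring
  have h := NullEquiv.eichler hv H.left hu fun u' hu' => H.one_add_mem hu'
  rw [← hβdef] at h
  obtain ⟨s, hs⟩ : ∃ s : ℝ, v - β • u + polar Q v u • e - (Q u * β) • e = s • e + β • f := by
    refine ⟨polar Q v f + polar Q v u - Q u * β, ?_⟩
    have : β • u = v - polar Q v f • e - β • f := by
      simp only [u, smul_smul, mul_inv_cancel₀ hβ, one_smul]
    rw [this]; module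
  rw [hs] at h
  have hQ := h.1
  rw [H.map_plane] at hQ
  rwa [hQ, mul_div_cancel_right₀ _ hβ]

/-- An Eichler transformation along `f` makes an anisotropic vector non-orthogonal to `e`. -/
lemma exists_nullEquiv_polar_ne_zero (H : IsHyperbolicTriple Q e f y) (hv : Q v ≠ 0) :
    ∃ v', NullEquiv Q v v' ∧ polar Q v' e ≠ 0 := by
  by_cases hβ : polar Q v e = 0
  swap
  · exact ⟨v, NullEquiv.refl hv, hβ⟩
  have hee : polar Q e e = 0 := by rw [polar_self_real, H.left, mul_zero]
  have hfe : polar Q f e = 1 := by rw [polar_comm, H.pair]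
  set α := polar Q v f with hα
  obtain ⟨t, ht⟩ : ∃ t : ℝ, t * (2 - t * α) ≠ 0 := by
    by_cases h2 : α = 2
    · exact ⟨-1, by rw [h2]; norm_num⟩
    · exact ⟨1, by simpa [sub_eq_zero] using Ne.symm h2⟩
  let u : V := t • (v - α • e)
  have hu : polar Q f u = 0 := by
    simp only [u, polar_smul_right, polar_sub_right, smul_eq_mul, hfe]
    rw [polar_comm Q f v, ← hα]; ring
  refine ⟨_, NullEquiv.eichler hv H.right hu fun u' hu' => H.swap.one_add_mem hu', ?_⟩
  have hue : polar Q u e = 0 := by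
    simp [u, polar_smul_left, polar_sub_left, hβ, hee]
  have hvu : polar Q v u = t * (2 * Q v) := by
    simp [u, polar_smul_right, polar_sub_right, hβ]
  have hQu : Q u = t * t * Q v := by
    simp [u, QuadraticMap.map_smul, map_sub_real, polar_smul_right, hβ, H.left]
  have : polar Q (v - α • u + polar Q v u • f - (Q u * α) • f) e = t * (2 - t * α) * Q v := by
    simp only [polar_add_left, polar_sub_left, polar_smul_left, smul_eq_mul, hue, hfe, hβ, hvu,
      hQu]
    ring
  rw [this]
  exact mul_ne_zero ht hv

/-- Vectors of the hyperbolic plane of the same length are equivalent, through a vector with a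
component along `y`. -/
lemma nullEquiv_plane_plane (H : IsHyperbolicTriple Q e f y) {ε β β' : ℝ} (hε : ε ≠ 0)
    (hβ : β ≠ 0) (hβ' : β' ≠ 0) (hpos : 0 ≤ (1 - β / β') * ε / Q y) :
    NullEquiv Q ((ε / β) • e + β • f) ((ε / β') • e + β' • f) := by
  set t := Real.sqrt ((1 - β / β') * ε / Q y)
  have ht : t * t * Q y = (1 - β / β') * ε := by
    rw [Real.mul_self_sqrt hpos, div_mul_cancel₀ _ H.aniso]
  have hee : polar Q e e = 0 := by rw [polar_self_real, H.left, mul_zero]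
  have hff : polar Q f f = 0 := by rw [polar_self_real, H.right, mul_zero]
  have hye : polar Q y e = 0 := by rw [polar_comm, H.left_orth]
  have hyf : polar Q y f = 0 := by rw [polar_comm, H.right_orth]
  have hfe : polar Q f e = 1 := by rw [polar_comm, H.pair]
  let x := (ε / β') • e + β • f + t • y
  have hx : Q x = ε := by
    simp only [x]
    rw [QuadraticMap.map_add Q, H.map_plane, QuadraticMap.map_smul, smul_eq_mul, ht]
    simp only [polar_add_left, polar_smul_left, polar_smul_right, H.left_orth, H.right_orth]
    simp only [smul_eq_mul, mul_zero, add_zero]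
    field_simp
    ring
  have hxe : polar Q x e = β := by
    simp [x, polar_add_left, polar_smul_left, hee, hfe, hye]
  have hxf : polar Q x f = ε / β' := by
    simp [x, polar_add_left, polar_smul_left, hff, H.pair, hyf]
  have hx0 : Q x ≠ 0 := hx ▸ hε
  have h1 := H.nullEquiv_plane hx0 (hxe ▸ hβ)
  have h2 := H.swap.nullEquiv_plane hx0 (by rw [hxf]; exact div_ne_zero hε hβ')
  rw [hx, hxe] at h1
  rw [hx, hxf, add_comm, div_div_cancel₀ hε] at h2
  have h0 : Q ((ε / β) • e + β • f) ≠ 0 := by rwa [H.map_plane, div_mul_cancel₀ _ hβ]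
  exact h1.symm.trans h0 h2

/-- Null rotations act transitively, up to sign, on the vectors of a given nonzero length. -/
lemma nullEquiv_or_neg (H : IsHyperbolicTriple Q e f y) (hv : Q v ≠ 0) :
    NullEquiv Q v (Q v • e + f) ∨ NullEquiv Q v (-(Q v • e + f)) := by
  obtain ⟨v', hvv', hv'⟩ := H.exists_nullEquiv_polar_ne_zero hv
  have h := hvv'.trans hv (H.nullEquiv_plane (hvv'.1 ▸ hv) hv')
  rw [← hvv'.1] at h
  set β := polar Q v' e
  set ε := Q v with hε
  have hconn : ∀ β' : ℝ, β' ≠ 0 → 0 < β / β' →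
      NullEquiv Q ((ε / β) • e + β • f) ((ε / β') • e + β' • f) := by
    intro β' hβ' hpos
    -- `1 - β / β'` and `1 - β' / β` have opposite signs, so one of the two directions applies.
    by_cases hs : 0 ≤ (1 - β / β') * ε / Q y
    · exact H.nullEquiv_plane_plane hv hv' hβ' hs
    · refine (H.nullEquiv_plane_plane hv hβ' hv' ?_).symm
      have : (1 - β' / β) * ε / Q y = (β / β')⁻¹ * -((1 - β / β') * ε / Q y) := by
        field_simp; ring
      rw [this]
      exact mul_nonneg (inv_nonneg.2 hpos.le) (by linarith)
  rcases lt_or_gt_of_ne hv' with hneg | hpos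
  · right
    have := h.trans hv (hconn (-1) (by norm_num) (by rw [div_neg, div_one]; linarith))
    have e1 : (-ε) • e + (-1 : ℝ) • f = -(ε • e + f) := by module
    rwa [div_neg, div_one, e1] at this
  · left
    have := h.trans hv (hconn 1 one_ne_zero (by simpa using hpos))
    rwa [div_one, one_smul] at this

/-- On the vectors of the same length as `y`, null rotations act transitively without the sign
ambiguity; in particular they connect `v` to `-v`, with quotient `-1`. -/
lemma neg_one_mem (H : IsHyperbolicTriple Q e f y) : -1 ∈ nullRotations Q := by
  have h := (H.nullEquiv_plane_plane (ε := Q y) (β := 1) (β' := -1) H.aniso one_ne_zero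
    (by norm_num) (by field_simp [H.aniso]; norm_num)).2
  have hQ : Q ((Q y / 1) • e + (1 : ℝ) • f) = Q y := by rw [H.map_plane]; ring
  have hneg : (Q y / -1) • e + (-1 : ℝ) • f = -((Q y / 1) • e + (1 : ℝ) • f) := by module
  rw [hneg, map_neg, mul_neg, ι_mul_self, hQ, smul_neg, smul_smul, inv_mul_cancel₀ H.aniso,
    one_smul] at h
  exact h

/-- The quotient of two vectors of the same nonzero length is a product of null rotations. -/
lemma nullEquiv (H : IsHyperbolicTriple Q e f y) (hv : Q v ≠ 0) (hvw : Q v = Q w) :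
    NullEquiv Q v w := by
  have hneg : ∀ x, NullEquiv Q v (-x) → NullEquiv Q v x := by
    intro x hx
    refine ⟨by simpa using hx.1, ?_⟩
    simpa using mul_mem H.neg_one_mem hx.2
  have hall : ∀ x, Q x = Q v → NullEquiv Q x (Q v • e + f) ∨ NullEquiv Q (-x) (Q v • e + f) := by
    intro x hx
    rcases H.nullEquiv_or_neg (v := x) (hx ▸ hv) with h | h
    · exact Or.inl (hx ▸ h)
    · exact Or.inr (by simpa [hx] using h.neg)
  rcases hall v rfl with h1 | h1 <;> rcases hall w hvw.symm with h2 | h2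
  · exact h1.trans hv h2.symm
  · exact hneg _ (h1.trans hv h2.symm)
  · exact hneg _ (by simpa using (h1.trans (by simpa using hv) h2.symm).neg)
  · simpa using (h1.trans (by simpa using hv) h2.symm).neg

end IsHyperbolicTriple

/-- A product of null rotations can be moved past an anisotropic vector. -/
lemma exists_mul_ι_eq {v : V} (hv : Q v ≠ 0) {u : CliffordAlgebra Q} (hu : u ∈ nullRotations Q) :
    ∃ u' ∈ nullRotations Q, u * ι Q v = ι Q v * u' :=
  ⟨_, conj_mem_nullRotations hv hu, by
    rw [mul_smul_comm, ← mul_assoc, ← mul_assoc, ι_mul_self, smul_mul_assoc, smul_mul_assoc,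
      one_mul, smul_smul, inv_mul_cancel₀ hv, one_smul]⟩

/-- An anisotropic vector is, up to a scalar, a reference vector of the sign of its length times
a product of null rotations. -/
lemma IsHyperbolicTriple.exists_ι_eq {e f y v : V} (H : IsHyperbolicTriple Q e f y)
    (hv : Q v ≠ 0) : ∃ c : ℝ, c ≠ 0 ∧ ∃ p : V, (p = e + f ∨ p = e - f) ∧
      ∃ u ∈ nullRotations Q, ι Q v = c • (ι Q p * u) := by
  have hp : Q (e + f) = 1 := by simpa using H.map_plane 1 1
  have hm : Q (e - f) = -1 := by simpa [sub_eq_add_neg] using H.map_plane 1 (-1)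
  have key : ∀ p : V, Q p ≠ 0 → 0 < Q v / Q p →
      ∃ c : ℝ, c ≠ 0 ∧ ∃ u ∈ nullRotations Q, ι Q v = c • (ι Q p * u) := by
    intro p hp hpos
    set s := Real.sqrt (Q v / Q p)
    have hs : s * s = Q v / Q p := Real.mul_self_sqrt hpos.le
    have hs0 : s ≠ 0 := (Real.sqrt_pos.2 hpos).ne'
    have hQ : Q p = Q (s⁻¹ • v) := by
      rw [QuadraticMap.map_smul, ← mul_inv, hs, smul_eq_mul]; field_simp
    refine ⟨s, hs0, _, (H.nullEquiv hp hQ).2, ?_⟩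
    rw [mul_smul_comm, ← mul_assoc, ι_mul_self, map_smul, smul_mul_assoc, one_mul,
      inv_smul_smul₀ hp, smul_inv_smul₀ hs0]
  rcases lt_or_gt_of_ne hv with h | h
  · obtain ⟨c, hc, u, hu, hvu⟩ := key (e - f) (by rw [hm]; norm_num) (by rw [hm]; linarith)
    exact ⟨c, hc, _, Or.inr rfl, u, hu, hvu⟩
  · obtain ⟨c, hc, u, hu, hvu⟩ := key (e + f) (by rw [hp]; norm_num) (by rw [hp]; linarith)
    exact ⟨c, hc, _, Or.inl rfl, u, hu, hvu⟩

/-- The coset representatives of the products of null rotations in the Lipschitz group, up to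
scalars: `1`, the reference vectors `p` and `m` of length `1` and `-1`, and `p m`. -/
def cosetReps (p m : CliffordAlgebra Q) : Set (CliffordAlgebra Q) := {1, p, m, p * m}

/-- Elements of the Lipschitz group are, up to a scalar, a coset representative times a product of
null rotations. -/
lemma IsHyperbolicTriple.exists_eq_of_mem_lipschitzGroup {e f y : V}
    (H : IsHyperbolicTriple Q e f y) {x : (CliffordAlgebra Q)ˣ} (hx : x ∈ lipschitzGroup Q) :
    ∃ c : ℝ, c ≠ 0 ∧ ∃ q ∈ cosetReps (ι Q (e + f)) (ι Q (e - f)), ∃ u ∈ nullRotations Q,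
      (x : CliffordAlgebra Q) = c • (q * u) := by
  have hp : Q (e + f) = 1 := by simpa using H.map_plane 1 1
  have hm : Q (e - f) = -1 := by simpa [sub_eq_add_neg] using H.map_plane 1 (-1)
  have hpm : polar Q (e + f) (e - f) = 0 := by
    simp only [polar_add_left, polar_sub_right, polar_self_real, H.left, H.right]
    rw [polar_comm Q f e]; ring
  have hpp := ι_mul_self (Q := Q) (e + f)
  have hmm := ι_mul_self (Q := Q) (e - f)
  have hanti : ι Q (e - f) * ι Q (e + f) = -(ι Q (e + f) * ι Q (e - f)) :=
    ι_mul_ι_anticomm (by rwa [polar_comm])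
  rw [hp, one_smul] at hpp
  rw [hm, neg_one_smul] at hmm
  have hp0 : Q (e + f) ≠ 0 := by rw [hp]; norm_num
  have hm0 : Q (e - f) ≠ 0 := by rw [hm]; norm_num
  have hmove : ∀ q ∈ cosetReps (ι Q (e + f)) (ι Q (e - f)), ∀ u ∈ nullRotations Q,
      ∃ u' ∈ nullRotations Q, u * q = q * u' := by
    rintro q (rfl | rfl | rfl | rfl) u hu
    · exact ⟨u, hu, by simp⟩
    · exact exists_mul_ι_eq hp0 hu
    · exact exists_mul_ι_eq hm0 hu
    · obtain ⟨u', hu', h1⟩ := exists_mul_ι_eq hp0 hu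
      obtain ⟨u'', hu'', h2⟩ := exists_mul_ι_eq hm0 hu'
      exact ⟨u'', hu'', by rw [← mul_assoc, h1, mul_assoc, h2, mul_assoc]⟩
  have htable : ∀ p : V, (p = e + f ∨ p = e - f) →
      ∀ q ∈ cosetReps (ι Q (e + f)) (ι Q (e - f)),
      ∃ s : ℝ, s ≠ 0 ∧ ∃ q' ∈ cosetReps (ι Q (e + f)) (ι Q (e - f)), ι Q p * q = s • q' := by
    set p := ι Q (e + f)
    set m := ι Q (e - f)
    rintro _ (rfl | rfl) q (rfl | rfl | rfl | rfl)
    · exact ⟨1, one_ne_zero, p, by simp [cosetReps], by simp [p]⟩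
    · exact ⟨1, one_ne_zero, 1, by simp [cosetReps], by rw [one_smul]; exact hpp⟩
    · exact ⟨1, one_ne_zero, p * m, by simp [cosetReps], by simp [p]⟩
    · exact ⟨1, one_ne_zero, m, by simp [cosetReps], by rw [← mul_assoc, hpp]; simp⟩
    · exact ⟨1, one_ne_zero, m, by simp [cosetReps], by simp [m]⟩
    · exact ⟨-1, by norm_num, p * m, by simp [cosetReps], by rw [hanti]; simp⟩
    · exact ⟨-1, by norm_num, 1, by simp [cosetReps], by rw [hmm]; simp⟩
    · refine ⟨1, one_ne_zero, p, by simp [cosetReps], ?_⟩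
      rw [← mul_assoc, hanti, neg_mul, mul_assoc, hmm]; simp
  have hstep : ∀ (v : V), Q v ≠ 0 → ∀ x : CliffordAlgebra Q,
      (∃ c : ℝ, c ≠ 0 ∧ ∃ q ∈ cosetReps (ι Q (e + f)) (ι Q (e - f)), ∃ u ∈ nullRotations Q,
        x = c • (q * u)) → ∀ r : ℝ, r ≠ 0 →
      ∃ c : ℝ, c ≠ 0 ∧ ∃ q ∈ cosetReps (ι Q (e + f)) (ι Q (e - f)), ∃ u ∈ nullRotations Q,
        (r • ι Q v) * x = c • (q * u) := by
    rintro v hv x ⟨c, hc, q, hq, u, hu, rfl⟩ r hr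
    obtain ⟨c₀, hc₀, p, hp, u₀, hu₀, hvp⟩ := H.exists_ι_eq hv
    obtain ⟨u₁, hu₁, h1⟩ := hmove q hq u₀ hu₀
    obtain ⟨s, hs, q', hq', h2⟩ := htable p hp q hq
    refine ⟨r * c₀ * c * s, by positivity, q', hq', u₁ * u, mul_mem hu₁ hu, ?_⟩
    calc (r • ι Q v) * (c • (q * u)) = (r * c₀ * c) • (ι Q p * (u₀ * q) * u) := by
          rw [hvp, smul_smul, smul_mul_smul_comm]; simp only [mul_assoc]
      _ = (r * c₀ * c) • ((ι Q p * q) * (u₁ * u)) := by rw [h1]; simp only [mul_assoc]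
      _ = _ := by rw [h2, smul_mul_assoc, smul_smul]
  induction hx using Subgroup.closure_induction_left with
  | one => exact ⟨1, one_ne_zero, 1, by simp [cosetReps], 1, one_mem _, by simp⟩
  | mul_left g hg x _ ih =>
    obtain ⟨v, hv⟩ := hg
    have hQv : Q v ≠ 0 := (isUnit_of_isUnit_ι Q (hv ▸ g.isUnit)).ne_zero
    simpa [← hv] using hstep v hQv x ih 1 one_ne_zero
  | inv_mul_cancel g hg x _ ih =>
    obtain ⟨v, hv⟩ := hg
    have hQv : Q v ≠ 0 := (isUnit_of_isUnit_ι Q (hv ▸ g.isUnit)).ne_zero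
    have hinv : ((g⁻¹ : (CliffordAlgebra Q)ˣ) : CliffordAlgebra Q) = (Q v)⁻¹ • ι Q v := by
      refine Units.inv_eq_of_mul_eq_one_right ?_
      rw [← hv, mul_smul_comm, ι_mul_self, smul_smul, inv_mul_cancel₀ hQv, one_smul]
    rw [Units.val_mul, hinv]
    exact hstep v hQv x ih _ (inv_ne_zero hQv)

/-- The spin group is generated by null rotations. -/
theorem IsHyperbolicTriple.mem_nullRotations_of_mem_spinGroup {e f y : V}
    (H : IsHyperbolicTriple Q e f y) {x : CliffordAlgebra Q} (hx : x ∈ spinGroup Q) :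
    x ∈ nullRotations Q := by
  have hm : Q (e - f) = -1 := by simpa [sub_eq_add_neg] using H.map_plane 1 (-1)
  have hp : Q (e + f) = 1 := by simpa using H.map_plane 1 1
  obtain ⟨x', hx', rfl⟩ := pinGroup.mem_lipschitzGroup (spinGroup.mem_pin hx)
  obtain ⟨c, hc, q, hq, u, hu, hxq⟩ := H.exists_eq_of_mem_lipschitzGroup hx'
  simp only [Units.coeHom_apply] at hx ⊢
  have heven := spinGroup.involute_eq hx
  have hstar := spinGroup.star_mul_self_of_mem hx
  have huu := reverse_mul_self_nullRotations hu
  have hui := involute_nullRotations hu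
  -- The representatives `p` and `m` are odd, so an even unit does not lie in their cosets.
  have hodd : ∀ v : V, q ≠ ι Q v := by
    rintro v rfl
    rw [hxq, map_smul, map_mul, involute_ι, hui, neg_mul, smul_neg, neg_eq_iff_add_eq_zero,
      ← two_smul ℝ, ← hxq] at heven
    exact x'.ne_zero ((smul_eq_zero.1 heven).resolve_left two_ne_zero)
  have hnorm : (c * c) • (reverse u * (reverse (involute q) * q) * u) = 1 := by
    rw [← hstar, hxq, star_def, map_smul, map_smul, map_mul, hui, reverse.map_mul,
      smul_mul_smul_comm]
    simp only [mul_assoc]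
  rcases hq with rfl | rfl | rfl | rfl
  · have hcc : c * c = 1 := by
      apply algebraMap_clifford_injective (Q := Q)
      rw [Algebra.algebraMap_eq_smul_one, map_one]
      simpa [huu] using hnorm
    rw [hxq, one_mul]
    rcases mul_self_eq_one_iff.1 hcc with rfl | rfl
    · simpa using hu
    · simpa using mul_mem H.neg_one_mem hu
  · exact absurd rfl (hodd _)
  · exact absurd rfl (hodd _)
  · -- The coset of `p m` has spinor norm of the wrong sign.
    have h1 : reverse (involute (ι Q (e + f) * ι Q (e - f))) * (ι Q (e + f) * ι Q (e - f))
        = (-1 : ℝ) • 1 := by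
      simp only [map_mul, involute_ι, reverse.map_mul, reverse_ι, neg_mul_neg]
      rw [mul_assoc, ← mul_assoc (ι Q (e + f)), ι_mul_self, hp, one_smul, one_mul, ι_mul_self, hm]
    rw [h1, mul_smul_comm, smul_mul_assoc, mul_one, huu, smul_smul,
      ← Algebra.algebraMap_eq_smul_one, ← map_one (algebraMap ℝ (CliffordAlgebra Q))] at hnorm
    have := algebraMap_clifford_injective hnorm
    nlinarith [mul_self_nonneg c]

end Generation

/-! ### Boosts contract null rotations -/

section Boosts

open CliffordAlgebra QuadraticMap

variable {V : Type*} [AddCommGroup V] [Module ℝ V] {Q : QuadraticForm ℝ V}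

lemma ι_mul_ι_mem_spinGroup {v w : V} (h : Q v * Q w = 1) : ι Q v * ι Q w ∈ spinGroup Q := by
  have hv : Q v ≠ 0 := left_ne_zero_of_mul_eq_one h
  have hw : Q w ≠ 0 := right_ne_zero_of_mul_eq_one h
  obtain ⟨v', hv'⟩ := (isUnit_ι_iff Q (m := v)).2 hv.isUnit
  obtain ⟨w', hw'⟩ := (isUnit_ι_iff Q (m := w)).2 hw.isUnit
  refine spinGroup.mem_iff.2 ⟨pinGroup.mem_iff.2 ⟨⟨v' * w', ?_, by simp [hv', hw']⟩, ?_⟩, ?_⟩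
  · exact Subgroup.mul_mem _ (Subgroup.subset_closure ⟨v, hv'.symm⟩)
      (Subgroup.subset_closure ⟨w, hw'.symm⟩)
  · rw [Unitary.mem_iff]
    have hmid : ∀ a b : V, ι Q a * ι Q b * (ι Q b * ι Q a) = (Q a * Q b) • 1 := by
      intro a b
      rw [mul_assoc, ← mul_assoc (ι Q b), ι_mul_self, smul_mul_assoc, one_mul, mul_smul_comm,
        ι_mul_self, smul_smul, mul_comm]
    simp only [star_mul, star_ι, neg_mul_neg, hmid]
    rw [mul_comm, h, one_smul]; simp
  · exact ι_mul_ι_mem_evenOdd_zero Q v w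

lemma one_add_mem_spinGroup {n u : V} (hn : Q n = 0) (hnu : polar Q n u = 0) (hu : Q u ≠ 0) :
    1 + ι Q n * ι Q u ∈ spinGroup Q := by
  have h : 1 + ι Q n * ι Q u = ι Q (n + (Q u)⁻¹ • u) * ι Q u := by
    rw [map_add, map_smul, add_mul, smul_mul_assoc, ι_mul_self, smul_smul, inv_mul_cancel₀ hu,
      one_smul, add_comm]
  rw [h]
  apply ι_mul_ι_mem_spinGroup
  rw [QuadraticMap.map_add Q, hn, QuadraticMap.map_smul, polar_smul_right, hnu]
  simp only [smul_eq_mul]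
  field_simp
  ring

/-- The boost that scales the null vectors of a hyperbolic pair by `1/4` and `4`. -/
lemma exists_boost {e f : V} (he : Q e = 0) (hf : Q f = 0) (hef : polar Q e f = 1) :
    ∃ a : spinGroup Q, spinActFun Q a e = (1 / 4 : ℝ) • e ∧
      ∀ u, polar Q e u = 0 → polar Q f u = 0 → spinActFun Q a u = u := by
  have hee : polar Q e e = 0 := by rw [polar_self_real, he, mul_zero]
  have hff : polar Q f f = 0 := by rw [polar_self_real, hf, mul_zero]
  have hfe : polar Q f e = 1 := by rw [polar_comm, hef]
  -- `a = p q` with unit vectors `p, q` of the hyperbolic plane; `p` and `q` act by reflections.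
  set p := e + f
  set q := (2 : ℝ) • e + (1 / 2 : ℝ) • f
  have hp : Q p = 1 := by rw [QuadraticMap.map_add Q, he, hf, hef]; ring
  have hq : Q q = 1 := by
    rw [QuadraticMap.map_add Q, QuadraticMap.map_smul, QuadraticMap.map_smul, he, hf,
      polar_smul_left, polar_smul_right, hef]
    norm_num
  let a : spinGroup Q := ⟨ι Q p * ι Q q, ι_mul_ι_mem_spinGroup (by rw [hp, hq, one_mul])⟩
  have ha : ∀ v, spinActFun Q a v =
      polar Q p (polar Q q v • q - v) • p - (polar Q q v • q - v) := by
    intro v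
    apply ι_injective Q
    have h1 := ι_mul_ι_mul_ι (Q := Q) q v
    have h2 := ι_mul_ι_mul_ι (Q := Q) p (polar Q q v • q - Q q • v)
    rw [hq, one_smul] at h1 h2
    rw [hp, one_smul] at h2
    rw [ι_spinActFun, ← h2, ← h1]
    simp only [a, star_mul, star_ι, neg_mul_neg]
    simp only [mul_assoc]
  refine ⟨a, ?_, fun u heu hfu => ?_⟩
  · rw [ha]
    simp only [p, q, polar_add_left, polar_smul_left, polar_sub_right, polar_add_right,
      polar_smul_right, hee, hff, hef, hfe, smul_eq_mul]
    module
  · rw [ha]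
    simp only [p, q, polar_add_left, polar_smul_left, polar_sub_right, polar_add_right,
      polar_smul_right, hee, hff, hef, hfe, smul_eq_mul, heu, hfu]
    module

/-- A nonzero null vector belongs to a hyperbolic pair. -/
lemma exists_hyperbolic_partner (hQ : ∀ v, (∀ w, polar Q v w = 0) → v = 0) {n : V} (hn : Q n = 0)
    (hn0 : n ≠ 0) : ∃ f, Q f = 0 ∧ polar Q n f = 1 := by
  obtain ⟨z, hz⟩ : ∃ z, polar Q n z ≠ 0 := by
    by_contra! h; exact hn0 (hQ n h)
  have hnn : polar Q n n = 0 := by rw [polar_self_real, hn, mul_zero]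
  obtain ⟨z', hz'⟩ : ∃ z', polar Q n z' = 1 :=
    ⟨(polar Q n z)⁻¹ • z, by simp [polar_smul_right, inv_mul_cancel₀ hz]⟩
  refine ⟨z' - Q z' • n, ?_, ?_⟩
  · rw [map_sub_real, QuadraticMap.map_smul, hn, polar_smul_right, polar_comm, hz']
    simp
  · rw [polar_sub_right, polar_smul_right, hz', hnn]; simp

/-- The hyperbolic partner of a null vector can be chosen orthogonal to a given anisotropic
vector that is orthogonal to the null vector. -/
lemma exists_hyperbolic_partner_orthogonal (hQ : ∀ v, (∀ w, polar Q v w = 0) → v = 0) {n u : V}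
    (hn : Q n = 0) (hn0 : n ≠ 0) (hnu : polar Q n u = 0) (hu : Q u ≠ 0) :
    ∃ f, Q f = 0 ∧ polar Q n f = 1 ∧ polar Q f u = 0 := by
  obtain ⟨z, -, hz⟩ := exists_hyperbolic_partner hQ hn hn0
  have hnn : polar Q n n = 0 := by rw [polar_self_real, hn, mul_zero]
  set z' := z - (polar Q z u / (2 * Q u)) • u
  have hz' : polar Q n z' = 1 := by
    simp [z', polar_sub_right, polar_smul_right, hz, hnu]
  have hz'u : polar Q z' u = 0 := by
    simp only [z', polar_sub_left, polar_smul_left, polar_self_real, smul_eq_mul]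
    field_simp
    ring
  refine ⟨z' - Q z' • n, ?_, ?_, ?_⟩
  · rw [map_sub_real, QuadraticMap.map_smul, hn, polar_smul_right, polar_comm, hz']
    simp
  · rw [polar_sub_right, polar_smul_right, hz', hnn]; simp
  · rw [polar_sub_left, polar_smul_left, hz'u, hnu]; simp

variable (Q) in
/-- The one-parameter groups `1 + t n u` of null rotations. -/
def nullCurves : Set (ℝ → spinGroup Q) :=
  {x | ∃ n u, Q n = 0 ∧ polar Q n u = 0 ∧ Q u ≠ 0 ∧
    ∀ t, (x t : CliffordAlgebra Q) = 1 + t • (ι Q n * ι Q u)}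

lemma nullCurves_zero {x : ℝ → spinGroup Q} (hx : x ∈ nullCurves Q) : x 0 = 1 := by
  obtain ⟨n, u, -, -, -, h⟩ := hx
  exact Subtype.ext (by simp [h])

lemma isSmoothSpinCurve_of_mem_nullCurves {x : ℝ → spinGroup Q} (hx : x ∈ nullCurves Q) :
    IsSmoothSpinCurve x := by
  obtain ⟨n, u, -, -, -, h⟩ := hx
  intro l
  simp only [h, map_add, map_smul, smul_eq_mul]
  fun_prop

lemma closure_nullCurves {e f y : V} (H : IsHyperbolicTriple Q e f y) :
    Subgroup.closure {γ | ∃ x ∈ nullCurves Q, ∃ t, x t = γ} = ⊤ := by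
  set S := Subgroup.closure {γ | ∃ x ∈ nullCurves Q, ∃ t, x t = γ} with hS
  have hle : nullRotations Q ≤ S.toSubmonoid.map (spinGroup Q).subtype := by
    refine Submonoid.closure_le.2 ?_
    rintro _ ⟨n, u, hn, hnu, hu, rfl⟩
    let x : ℝ → spinGroup Q := fun t => ⟨1 + ι Q (t • n) * ι Q u, one_add_mem_spinGroup
      (by simp [QuadraticMap.map_smul, hn]) (by simp [polar_smul_left, hnu]) hu⟩
    refine ⟨x 1, Subgroup.subset_closure ⟨x, ⟨n, u, hn, hnu, hu, fun t => ?_⟩, 1, rfl⟩, ?_⟩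
    · simp [x]
    · simp [x]
  rw [eq_top_iff]
  rintro γ -
  obtain ⟨γ', hγ', h⟩ := hle (H.mem_nullRotations_of_mem_spinGroup γ.2)
  rwa [← Subtype.ext h]

/-- A boost that scales `n` contracts the null rotations `1 + t n u`. -/
lemma nullCurves_contracted (hQ : ∀ v, (∀ w, polar Q v w = 0) → v = 0) {x : ℝ → spinGroup Q}
    (hx : x ∈ nullCurves Q) :
    ∃ a : spinGroup Q, ∃ r : ℝ, |r| < 1 ∧ ∀ t, a * x t * a⁻¹ = x (r * t) := by
  obtain ⟨n, u, hn, hnu, hu, h⟩ := hx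
  by_cases hn0 : n = 0
  · refine ⟨1, 0, by norm_num, fun t => Subtype.ext ?_⟩
    simp [h, hn0]
  obtain ⟨f, hf, hnf, hfu⟩ := exists_hyperbolic_partner_orthogonal hQ hn hn0 hnu hu
  obtain ⟨a, han, hau⟩ := exists_boost hn hf hnf
  refine ⟨a, 1 / 4, by rw [abs_of_pos] <;> norm_num, fun t => Subtype.ext ?_⟩
  have h1 := ι_spinActFun Q a n
  have h2 := ι_spinActFun Q a u
  rw [han, map_smul] at h1
  rw [hau u hnu hfu] at h2
  have hstar : star (a : CliffordAlgebra Q) * a = 1 := spinGroup.coe_star_mul_self a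
  have hstar' : (a : CliffordAlgebra Q) * star (a : CliffordAlgebra Q) = 1 :=
    spinGroup.coe_mul_star_self a
  rw [← spinGroup.star_eq_inv]
  simp only [Submonoid.coe_mul, spinGroup.coe_star, h]
  calc (a : CliffordAlgebra Q) * (1 + t • (ι Q n * ι Q u)) * star (a : CliffordAlgebra Q)
      = a * star (a : CliffordAlgebra Q) + t • ((a * ι Q n * star (a : CliffordAlgebra Q)) *
          (a * ι Q u * star (a : CliffordAlgebra Q))) := by
        have : (a * ι Q n * star (a : CliffordAlgebra Q)) *
            (a * ι Q u * star (a : CliffordAlgebra Q)) = a * ι Q n *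
              (star (a : CliffordAlgebra Q) * a) * ι Q u * star (a : CliffordAlgebra Q) := by
          simp only [mul_assoc]
        rw [this, hstar, mul_add, add_mul, mul_one, mul_one, mul_smul_comm, smul_mul_assoc]
        simp only [mul_assoc]
    _ = _ := by
        rw [hstar', ← h1, ← h2, smul_mul_assoc, smul_smul, mul_comm t]

end Boosts

/-! ### The Minkowski and conformal quadratic forms -/

section Signature

open QuadraticMap

variable {ι : Type*} [Fintype ι] (w : ι → ℝ)

lemma polar_weightedSumSquares (v u : ι → ℝ) :
    polar (weightedSumSquares ℝ w) v u = ∑ i, 2 * w i * v i * u i := by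
  simp only [polar, weightedSumSquares_apply, ← Finset.sum_sub_distrib, Pi.add_apply, smul_eq_mul]
  exact Finset.sum_congr rfl fun i _ => by ring

lemma polar_weightedSumSquares_nondegenerate (hw : ∀ i, w i ≠ 0) (v : ι → ℝ)
    (h : ∀ u, polar (weightedSumSquares ℝ w) v u = 0) : v = 0 := by
  classical
  ext i
  have := h (Pi.single i 1)
  rw [polar_weightedSumSquares, Finset.sum_eq_single i (by intro j _ hj; simp [hj]) (by simp)]
    at this
  simpa [hw i] using this

/-- A weighted sum of squares with weights `1`, `-1` and a further nonzero weight has a hyperbolic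
triple. -/
lemma exists_isHyperbolicTriple {i j k : ι} (hij : i ≠ j) (hik : i ≠ k) (hjk : j ≠ k)
    (hi : w i = 1) (hj : w j = -1) (hk : w k ≠ 0) :
    ∃ e f y, IsHyperbolicTriple (weightedSumSquares ℝ w) e f y := by
  classical
  have hQ : ∀ l, weightedSumSquares ℝ w (Pi.single l (1 : ℝ)) = w l := by
    intro l
    rw [weightedSumSquares_apply, Finset.sum_eq_single l (by intro j _ hj; simp [hj]) (by simp)]
    simp
  have hP : ∀ l m, l ≠ m → polar (weightedSumSquares ℝ w) (Pi.single l (1 : ℝ)) (Pi.single m 1)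
      = 0 := by
    intro l m hlm
    rw [polar_weightedSumSquares]
    refine Finset.sum_eq_zero fun a _ => ?_
    by_cases ha : a = l
    · subst ha; simp [Pi.single_eq_of_ne hlm]
    · simp [Pi.single_eq_of_ne ha]
  set Q := weightedSumSquares ℝ w
  set a : ι → ℝ := Pi.single i 1
  set b : ι → ℝ := Pi.single j 1
  set c : ι → ℝ := Pi.single k 1
  have ha : Q a = 1 := (hQ i).trans hi
  have hb : Q b = -1 := (hQ j).trans hj
  have hab : polar Q a b = 0 := hP i j hij
  have hba : polar Q b a = 0 := hP j i hij.symm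
  have hac : polar Q a c = 0 := hP i k hik
  have hbc : polar Q b c = 0 := hP j k hjk
  refine ⟨(1 / 2 : ℝ) • (a + b), (1 / 2 : ℝ) • (a - b), c, ?_, ?_, ?_, ?_, ?_, ?_⟩
  · rw [QuadraticMap.map_smul, QuadraticMap.map_add Q, ha, hb, hab]; norm_num
  · rw [QuadraticMap.map_smul, map_sub_real, ha, hb, hab]; norm_num
  · simp only [polar_smul_left, polar_smul_right, polar_add_left, polar_sub_right,
      polar_self_real, ha, hb, hab, hba]
    norm_num
  · simp [polar_smul_left, polar_add_left, hac, hbc]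
  · simp [polar_smul_left, polar_sub_left, hac, hbc]
  · exact (hQ k).trans_ne hk

lemma minkowskiWeight_ne_zero (d : ℕ) [NeZero d] (i : Fin d) : minkowskiWeight d i ≠ 0 := by
  unfold minkowskiWeight; split_ifs <;> norm_num

lemma conformalWeight_ne_zero (d : ℕ) [NeZero d] (i : Fin d ⊕ Fin 2) :
    conformalWeight d i ≠ 0 := by
  rcases i with i | i
  · exact minkowskiWeight_ne_zero d i
  · fin_cases i <;> simp [conformalWeight]

/-- The third direction, orthogonal to a hyperbolic pair, needs `d ≥ 3`. -/
lemma exists_isHyperbolicTriple_minkowski {d : ℕ} [NeZero d] (hd : 3 ≤ d) :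
    ∃ e f y, IsHyperbolicTriple (minkowskiForm d) e f y := by
  have h1 : (⟨1, by omega⟩ : Fin d) ≠ 0 := by simp [Fin.ext_iff]
  have h2 : (0 : Fin d) ≠ ⟨2, by omega⟩ := by simp [Fin.ext_iff]
  exact exists_isHyperbolicTriple (minkowskiWeight d) (i := ⟨1, by omega⟩) (j := 0)
    (k := ⟨2, by omega⟩) h1 (by simp) h2 (by simp [minkowskiWeight, h1])
    (by simp [minkowskiWeight]) (minkowskiWeight_ne_zero d _)

lemma exists_isHyperbolicTriple_conformal (d : ℕ) [NeZero d] :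
    ∃ e f y, IsHyperbolicTriple (conformalForm d) e f y :=
  exists_isHyperbolicTriple (conformalWeight d) (i := Sum.inr 0) (j := Sum.inr 1) (k := Sum.inl 0)
    (by simp) (by simp) (by simp) (by simp [conformalWeight]) (by simp [conformalWeight])
    (conformalWeight_ne_zero d _)

end Signature

/-! ### The Poincaré group -/

section Poincare

open QuadraticMap

variable {V : Type*} [AddCommGroup V] [Module ℝ V] {Q : QuadraticForm ℝ V}

variable (Q) in
/-- The translations along null directions, and the null rotations. -/
def poincareNullCurves : Set (ℝ → Multiplicative V ⋊[spinMulAut Q] spinGroup Q) :=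
  {x | (∃ n, Q n = 0 ∧ ∀ t, x t = SemidirectProduct.inl (Multiplicative.ofAdd (t • n))) ∨
    ∃ σ ∈ nullCurves Q, ∀ t, x t = SemidirectProduct.inr (σ t)}

lemma poincareNullCurves_zero {x : ℝ → Multiplicative V ⋊[spinMulAut Q] spinGroup Q}
    (hx : x ∈ poincareNullCurves Q) : x 0 = 1 := by
  rcases hx with ⟨n, -, h⟩ | ⟨σ, hσ, h⟩
  · simp [h]
  · simp [h, nullCurves_zero hσ]

/-- Every vector is a sum of null vectors. -/
lemma closure_null_eq_top {e f y : V} (H : IsHyperbolicTriple Q e f y) :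
    AddSubgroup.closure {n : V | Q n = 0} = ⊤ := by
  rw [eq_top_iff]
  rintro v -
  set β := polar Q v e
  set α := polar Q v f
  have hee : polar Q e e = 0 := by rw [polar_self_real, H.left, mul_zero]
  have hff : polar Q f f = 0 := by rw [polar_self_real, H.right, mul_zero]
  have hfe : polar Q f e = 1 := by rw [polar_comm, H.pair]
  obtain ⟨u, hu⟩ : ∃ u, u = v - α • e - β • f := ⟨_, rfl⟩
  have hue : polar Q u e = 0 := by
    simp [hu, polar_sub_left, polar_smul_left, hee, hfe, β]
  have huf : polar Q u f = 0 := by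
    simp [hu, polar_sub_left, polar_smul_left, hff, H.pair, α]
  have hn : Q (u + ((-Q u) • e + (1 : ℝ) • f)) = 0 := by
    rw [QuadraticMap.map_add Q, H.map_plane, polar_add_right, polar_smul_right, polar_smul_right,
      hue, huf]
    simp
  have hv : v = (u + ((-Q u) • e + (1 : ℝ) • f)) + (α + Q u) • e + (β - 1) • f := by
    rw [hu]; module
  rw [hv]
  refine add_mem (add_mem (AddSubgroup.subset_closure hn) (AddSubgroup.subset_closure ?_))
    (AddSubgroup.subset_closure ?_)
  · simp [QuadraticMap.map_smul, H.left]
  · simp [QuadraticMap.map_smul, H.right]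

lemma closure_poincareNullCurves {e f y : V} (H : IsHyperbolicTriple Q e f y) :
    Subgroup.closure {γ | ∃ x ∈ poincareNullCurves Q, ∃ t, x t = γ} = ⊤ := by
  set S := Subgroup.closure {γ | ∃ x ∈ poincareNullCurves Q, ∃ t, x t = γ}
  have hl : ∀ v : V, SemidirectProduct.inl (Multiplicative.ofAdd v) ∈ S := by
    intro v
    have hv : v ∈ AddSubgroup.closure {n : V | Q n = 0} :=
      closure_null_eq_top H ▸ AddSubgroup.mem_top v
    induction hv using AddSubgroup.closure_induction with
    | mem n hn =>
      exact Subgroup.subset_closure ⟨fun t => SemidirectProduct.inl (Multiplicative.ofAdd (t • n)),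
        Or.inl ⟨n, hn, fun _ => rfl⟩, 1, by simp⟩
    | zero => simp
    | add a b _ _ ha hb => rw [ofAdd_add, map_mul]; exact S.mul_mem ha hb
    | neg a _ ha => rw [ofAdd_neg, map_inv]; exact S.inv_mem ha
  have hr : ∀ σ : spinGroup Q, SemidirectProduct.inr σ ∈ S := by
    have : Subgroup.closure {γ | ∃ x ∈ nullCurves Q, ∃ t, x t = γ} ≤
        S.comap SemidirectProduct.inr := by
      rw [Subgroup.closure_le]
      rintro _ ⟨σ, hσ, t, rfl⟩
      exact Subgroup.subset_closure ⟨fun t => SemidirectProduct.inr (σ t),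
        Or.inr ⟨σ, hσ, fun _ => rfl⟩, t, rfl⟩
    rw [closure_nullCurves H] at this
    exact fun σ => this (Subgroup.mem_top σ)
  rw [eq_top_iff]
  rintro γ -
  rw [← SemidirectProduct.inl_left_mul_inr_right γ]
  exact S.mul_mem (hl (Multiplicative.toAdd γ.left)) (hr γ.right)

/-- A boost that scales `n` contracts the translations along `n` as well. -/
lemma poincareNullCurves_contracted (hQ : ∀ v, (∀ w, polar Q v w = 0) → v = 0)
    {x : ℝ → Multiplicative V ⋊[spinMulAut Q] spinGroup Q} (hx : x ∈ poincareNullCurves Q) :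
    ∃ a : Multiplicative V ⋊[spinMulAut Q] spinGroup Q, ∃ r : ℝ, |r| < 1 ∧
      ∀ t, a * x t * a⁻¹ = x (r * t) := by
  rcases hx with ⟨n, hn, h⟩ | ⟨σ, hσ, h⟩
  · by_cases hn0 : n = 0
    · exact ⟨1, 0, by norm_num, fun t => by simp [h, hn0]⟩
    obtain ⟨f, hf, hnf⟩ := exists_hyperbolic_partner hQ hn hn0
    obtain ⟨a, han, -⟩ := exists_boost hn hf hnf
    refine ⟨SemidirectProduct.inr a, 1 / 4, by rw [abs_of_pos] <;> norm_num, fun t => ?_⟩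
    rw [h, h, ← map_inv, ← SemidirectProduct.inl_aut]
    congr 1
    change Multiplicative.ofAdd (spinActFun Q a (t • n)) = _
    rw [map_smul, han, smul_smul, mul_comm t]
  · obtain ⟨a, r, hr, ha⟩ := nullCurves_contracted hQ hσ
    exact ⟨SemidirectProduct.inr a, r, hr, fun t => by rw [h, h, ← ha]; simp⟩

end Poincare

end QFT

end

/-! ### The discrete Coleman–Mandula theorem -/

open QFT

theorem mainTheorem4 {d : ℕ} [NeZero d]
    {H : Type*} [NormedAddCommGroup H] [InnerProductSpace ℂ H] [CompleteSpace H]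
    (T : QFT.QuantumFieldTheory d H) (K : QFT.Model)
    {E : Type*} [NormedAddCommGroup E] [NormedSpace ℝ E] [FiniteDimensional ℝ E]
    [CompleteSpace E]
    {G : Type*} [TopologicalSpace G] [T2Space G] [ChartedSpace E G] [Group G]
    [LieGroup 𝓘(ℝ, E) ∞ G]
    (S : QFT.GlobalSymmetry T K E G)
    (hcompact : IsCompact (S.internal : Set G))
    (P : Subgroup G)
    (hP : (3 ≤ d ∧ S.IsPoincareIdentityComponent P) ∨ S.IsConformalIdentityComponent P)
    (hCM : S.ColemanMandula P) :
    ∀ h ∈ S.internal, ∀ g ∈ P, h * g = g * h := by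
  obtain ⟨s, i, -, hPs, hi, -, hsi⟩ := hCM
  have hbr : ∀ X ∈ QFT.lieAlgebraOf (E := E) P,
      ∀ Y ∈ QFT.lieAlgebraOf (E := E) S.internal, ⁅X, Y⁆ = 0 :=
    fun X hX Y hY => hsi X (hPs hX) Y (hi.symm ▸ hY : Y ∈ (i : Set _))
  have hnormal : S.internal.Normal := MonoidHom.normal_ker S.f
  rintro h hh g hg
  rcases hP with ⟨hd, j, rfl, -, hj, -⟩ | ⟨j, rfl, -, hj, -⟩
  · obtain ⟨γ, rfl⟩ := hg
    obtain ⟨e, f, y, hefy⟩ := exists_isHyperbolicTriple_minkowski hd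
    refine commute_of_contracted_curves j hcompact hnormal hbr
      (poincareNullCurves (minkowskiForm d)) (closure_poincareNullCurves hefy)
      (fun x hx => poincareNullCurves_zero hx) (fun x hx => ?_)
      (fun x hx => poincareNullCurves_contracted
        (polar_weightedSumSquares_nondegenerate _ (minkowskiWeight_ne_zero d)) hx) hh γ
    rcases hx with ⟨n, -, hx⟩ | ⟨σ, hσ, hx⟩
    · simp only [hx]
      exact hj (fun t => t • n) (by fun_prop) (fun _ => 1) fun l => contDiff_const
    · simp only [hx]
      exact hj (fun _ => 0) contDiff_const σ (isSmoothSpinCurve_of_mem_nullCurves hσ)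
  · obtain ⟨γ, rfl⟩ := hg
    obtain ⟨e, f, y, hefy⟩ := exists_isHyperbolicTriple_conformal d
    exact commute_of_contracted_curves j hcompact hnormal hbr
      (nullCurves (conformalForm d)) (closure_nullCurves hefy)
      (fun x hx => nullCurves_zero hx)
      (fun x hx => hj x (isSmoothSpinCurve_of_mem_nullCurves hx))
      (fun x hx => nullCurves_contracted
        (polar_weightedSumSquares_nondegenerate _ (conformalWeight_ne_zero d)) hx) hh γ
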